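/- Let $\mathbb K$ be $\mathbb R$ or $\mathbb C$, and let $r,d\ge 2$ be integers. Let $\mathcal O_r(\mathbb K^d)$ be the set of ordered $r$-tuples $\mathcal A=(A_1,\dots,A_r)$ of $d\times d$ matrices over $\mathbb K$, with the metric $\max_i\|A_i-B_i\|$, where $\|\cdot\|$ is the operator norm induced by the Euclidean norm, and let $\mathcal I_r(\mathbb K^d)\subset\mathcal O_r(\mathbb K^d)$ be the set of irreducible tuples, i.e. those for which no linear subspace of $\mathbb K^d$ other than $\{0\}$ and $\mathbb K^d$ is invariant under every $A_i$. Write $\rho(M)$ for the spectral radius of a matrix $M$ (the largest modulus of its complex eigenvalues), and $$\varrho(\mathcal A)=\lim_{n\to\infty}\max\{\|A_{i_n}\cdots A_{i_1}\|^{1/n}: 1\le i_1,\dots,i_n\le r\}$$ for the joint spectral radius. For $n\ge 1$ let $\mathcal A_n=\{A_{i_n}\cdots A_{i_1}:1\le i_1,\dots,i_n\le r\}$. Then there is a nonempty open set $U\subset\mathcal O_r(\mathbb K^d)$ with $U\subset\mathcal I_r(\mathbb K^d)$ such that every $\mathcal A\in U$ has the following four properties. 1. (Finiteness property.) There are $n\ge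 1$ and $i_1,\dots,i_n\in\{1,\dots,r\}$ with $\rho(A_{i_n}\cdots A_{i_1})^{1/n}=\varrho(\mathcal A)$. 2. (Unbounded agreements property.) For every $N\in\mathbb N$ and all sequences $i,j:\mathbb N\to\{1,\dots,r\}$ with $\limsup_{n\to\infty}\|A_{i(n)}\cdots A_{i(1)}\|/\varrho(\mathcal A)^n>0$ and $\limsup_{n\to\infty}\|A_{j(n)}\cdots A_{j(1)}\|/\varrho(\mathcal A)^n>0$, there are $n_1,n_2\ge 1$ such that $i(n_1+k)=j(n_2+k)$ for all $1\le k\le N$. 3. (Rank one property.) $\varrho(\mathcal A)>0$, the set $\bigcup_{n\ge1}\varrho(\mathcal A)^{-n}\mathcal A_n$ is bounded, and every nonzero element of the limit semigroup $\bigcap_{m\ge1}\overline{\bigcup_{n\ge m}\varrho(\mathcal A)^{-n}\mathcal A_n}$ has rank one. 4. (Unique Barabanov norm.) There is a norm $\|\cdot\|_B$ on $\mathbb K^d$ such that $\varrho(\mathcal A)\|v\|_B=\max_{1\le i\le r}\|A_iv\|_B$ for all $v\in\mathbb K^d$, and any two norms with this property are positive scalar multiples of each other. -/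

import Mathlib

open Filter Topology
open scoped Matrix Matrix.Norms.L2Operator

noncomputable section

namespace MatrixTuple

variable {K : Type*} [RCLike K] {r d : ℕ}

/-- The space `O_r(K^d)` of ordered `r`-tuples of `d × d` matrices over `K`. With the scoped
instance opened above, `‖M‖` is the operator norm of a matrix `M` with respect to the Euclidean
norm, and the distance on this space is the maximum of the distances of the entries. -/
abbrev Tuple (K : Type*) (r d : ℕ) : Type _ := Fin r → Matrix (Fin d) (Fin d) K

/-- For a word `w = (i_1, …, i_n)`, the product `A_{i_n} ⋯ A_{i_1}`. -/
def wordProd (A : Tuple K r d) {n : ℕ} (w : Fin n → Fin r) : Matrix (Fin d) (Fin d) K :=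
  (List.ofFn fun k => A (w k)).reverse.prod

/-- The set `A_n` of all products of length `n`. -/
def prodSet (A : Tuple K r d) (n : ℕ) : Set (Matrix (Fin d) (Fin d) K) :=
  Set.range fun w : Fin n → Fin r => wordProd A w

/-- The joint spectral radius: the limit as `n → ∞` of the largest value of
`‖A_{i_n} ⋯ A_{i_1}‖^(1/n)` (see `tendsto_jointSpectralRadius`). -/
def jointSpectralRadius (A : Tuple K r d) : ℝ :=
  limUnder atTop fun n : ℕ => ⨆ w : Fin n → Fin r, ‖wordProd A w‖ ^ (1 / (n : ℝ))

/-- The spectral radius of a real or complex matrix: the largest modulus of its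
complex eigenvalues (also if `K = ℝ`). -/
def specRadius (M : Matrix (Fin d) (Fin d) K) : ℝ :=
  (spectralRadius ℂ (M.map (RCLike.map K ℂ))).toReal

/-- The finiteness property. -/
def FinitenessProperty (A : Tuple K r d) : Prop :=
  ∃ n : ℕ, 1 ≤ n ∧ ∃ w : Fin n → Fin r,
    specRadius (wordProd A w) ^ (1 / (n : ℝ)) = jointSpectralRadius A

/-- Irreducibility: the only common invariant subspaces of the `A_i` are `{0}` and `K^d`. -/
def Irred (A : Tuple K r d) : Prop :=
  ∀ V : Submodule K (Fin d → K), (∀ i, ∀ v ∈ V, A i *ᵥ v ∈ V) → V = ⊥ ∨ V = ⊤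

/-- A Barabanov norm for `A`: a norm (that is, a definite seminorm) on `K^d` such that
`ϱ(A) ‖v‖ = max_i ‖A_i v‖` for all `v`. -/
def IsBarabanovNorm (A : Tuple K r d) (N : Seminorm K (Fin d → K)) : Prop :=
  (∀ v, N v = 0 → v = 0) ∧
    ∀ v, IsGreatest (Set.range fun i => N (A i *ᵥ v)) (jointSpectralRadius A * N v)

/-- `A` has a Barabanov norm, and any two of them are proportional. -/
def HasUniqueBarabanovNorm (A : Tuple K r d) : Prop :=
  (∃ N, IsBarabanovNorm A N) ∧
    ∀ N N', IsBarabanovNorm A N → IsBarabanovNorm A N' → ∃ c : ℝ, 0 < c ∧ ∀ v, N' v = c * N v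

/-- The set of all products of the matrices in `A` is bounded. -/
def ProductBounded (A : Tuple K r d) : Prop :=
  Bornology.IsBounded (⋃ n ≥ 1, prodSet A n)

/-- `ϱ(A) > 0` and `ϱ(A)⁻¹ A` is product bounded. -/
def RelativelyProductBounded (A : Tuple K r d) : Prop :=
  0 < jointSpectralRadius A ∧ ProductBounded fun i => (jointSpectralRadius A)⁻¹ • A i

/-- The limit semigroup `S(A) = ⋂_{m ≥ 1} closure (⋃_{n ≥ m} ϱ(A)^(-n) A_n)`. -/
def limitSemigroup (A : Tuple K r d) : Set (Matrix (Fin d) (Fin d) K) :=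
  ⋂ m ≥ 1, closure (⋃ n ≥ m, (fun M => (jointSpectralRadius A ^ n)⁻¹ • M) '' prodSet A n)

/-- The rank one property. -/
def RankOneProperty (A : Tuple K r d) : Prop :=
  RelativelyProductBounded A ∧ ∀ M ∈ limitSemigroup A, M ≠ 0 → M.rank = 1

/-- The sequence `i` of indices satisfies
`limsup_n ‖A_{i(n)} ⋯ A_{i(1)}‖ / ϱ(A)^n > 0`, with the limsup taken in `[-∞, ∞]`.
The term numbered `k + 1` of the sequence is `i k`. -/
def NonVanishing (A : Tuple K r d) (i : ℕ → Fin r) : Prop :=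
  0 < limsup (fun n : ℕ =>
    ((‖wordProd A fun k : Fin n => i k‖ / jointSpectralRadius A ^ n : ℝ) : EReal)) atTop

/-- The unbounded agreements property: for every `N`, any two non-vanishing index sequences share
a common block of length `N`, starting after `n₁ ≥ 1` and `n₂ ≥ 1` terms respectively. -/
def UnboundedAgreements (A : Tuple K r d) : Prop :=
  ∀ N : ℕ, ∀ i j : ℕ → Fin r, NonVanishing A i → NonVanishing A j →
    ∃ n₁ n₂ : ℕ, 1 ≤ n₁ ∧ 1 ≤ n₂ ∧ ∀ k < N, i (n₁ + k) = j (n₂ + k)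

/-! The limit that defines the joint spectral radius exists. -/

/-- The largest norm of a product of length `n`. -/
def maxNorm (A : Tuple K r d) (n : ℕ) : ℝ := ⨆ w : Fin n → Fin r, ‖wordProd A w‖

theorem maxNorm_nonneg (A : Tuple K r d) (n : ℕ) : 0 ≤ maxNorm A n :=
  Real.iSup_nonneg fun _ => norm_nonneg _

theorem le_maxNorm (A : Tuple K r d) {n : ℕ} (w : Fin n → Fin r) :
    ‖wordProd A w‖ ≤ maxNorm A n :=
  le_ciSup (f := fun w : Fin n → Fin r => ‖wordProd A w‖) (Set.finite_range _).bddAbove w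

theorem wordProd_append (A : Tuple K r d) {m n : ℕ} (w : Fin (m + n) → Fin r) :
    wordProd A w = wordProd A (fun k : Fin n => w (Fin.natAdd m k)) *
      wordProd A (fun k : Fin m => w (Fin.castAdd n k)) := by
  simp only [wordProd, List.ofFn_add, List.reverse_append, List.prod_append]
  rfl

theorem maxNorm_add_le (A : Tuple K r d) (m n : ℕ) :
    maxNorm A (m + n) ≤ maxNorm A m * maxNorm A n := by
  refine Real.iSup_le (fun w => ?_) (mul_nonneg (maxNorm_nonneg A m) (maxNorm_nonneg A n))
  rw [wordProd_append, mul_comm (maxNorm A m)]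
  exact (norm_mul_le _ _).trans
    (mul_le_mul (le_maxNorm A _) (le_maxNorm A _) (norm_nonneg _) (maxNorm_nonneg A n))

theorem iSup_rpow_eq (A : Tuple K r d) {n : ℕ} (hn : n ≠ 0) :
    (⨆ w : Fin n → Fin r, ‖wordProd A w‖ ^ (1 / (n : ℝ))) = maxNorm A n ^ (1 / (n : ℝ)) := by
  have hp : (0 : ℝ) ≤ 1 / (n : ℝ) := by positivity
  have hne : (1 / (n : ℝ)) ≠ 0 := by positivity
  rcases isEmpty_or_nonempty (Fin n → Fin r) with h | h
  · simp only [maxNorm, Real.iSup_of_isEmpty, Real.zero_rpow hne]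
  · obtain ⟨w, hw⟩ := exists_eq_ciSup_of_finite (f := fun w : Fin n → Fin r => ‖wordProd A w‖)
    apply le_antisymm
    · exact ciSup_le fun w => Real.rpow_le_rpow (norm_nonneg _) (le_maxNorm A w) hp
    · rw [maxNorm, ← hw]
      exact le_ciSup (f := fun w : Fin n → Fin r => ‖wordProd A w‖ ^ (1 / (n : ℝ)))
        (Set.finite_range _).bddAbove w

theorem exists_tendsto (A : Tuple K r d) :
    ∃ x : ℝ, Tendsto (fun n : ℕ => ⨆ w : Fin n → Fin r, ‖wordProd A w‖ ^ (1 / (n : ℝ)))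
      atTop (𝓝 x) := by
  suffices h : ∃ x : ℝ, Tendsto (fun n : ℕ => maxNorm A n ^ (1 / (n : ℝ))) atTop (𝓝 x) by
    obtain ⟨x, hx⟩ := h
    refine ⟨x, hx.congr' ?_⟩
    filter_upwards [eventually_ne_atTop 0] with n hn
    exact (iSup_rpow_eq A hn).symm
  by_cases h0 : ∃ m, maxNorm A m = 0
  · obtain ⟨m, hm⟩ := h0
    refine ⟨0, tendsto_const_nhds.congr' ?_⟩
    filter_upwards [eventually_ge_atTop m, eventually_ne_atTop 0] with n hn hn0
    have h := maxNorm_add_le A m (n - m)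
    rw [hm, zero_mul, Nat.add_sub_cancel' hn] at h
    rw [le_antisymm h (maxNorm_nonneg A n), Real.zero_rpow (by positivity)]
  · have hpos : ∀ n, 0 < maxNorm A n := fun n =>
      lt_of_le_of_ne (maxNorm_nonneg A n) fun h => h0 ⟨n, h.symm⟩
    by_cases hb : BddBelow (Set.range fun n : ℕ => Real.log (maxNorm A n) / n)
    · have hs : Subadditive fun n => Real.log (maxNorm A n) := fun m n => by
        rw [← Real.log_mul (hpos m).ne' (hpos n).ne']
        exact Real.log_le_log (hpos _) (maxNorm_add_le A m n)
      refine ⟨Real.exp hs.lim, ((Real.continuous_exp.tendsto _).comp (hs.tendsto_lim hb)).congr ?_⟩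
      intro n
      simp only [Function.comp_apply]
      rw [Real.rpow_def_of_pos (hpos n), mul_one_div]
    · refine ⟨0, ?_⟩
      have hs : Subadditive fun n => Real.log (maxNorm A n) := fun m n => by
        rw [← Real.log_mul (hpos m).ne' (hpos n).ne']
        exact Real.log_le_log (hpos _) (maxNorm_add_le A m n)
      have ht : Tendsto (fun n : ℕ => Real.log (maxNorm A n) / n) atTop atBot := by
        refine tendsto_atBot.2 fun b => ?_
        have : ∃ n : ℕ, n ≠ 0 ∧ Real.log (maxNorm A n) / n < b := by
          by_contra hcon
          push Not at hcon
          refine hb ⟨min b 0, ?_⟩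
          rintro _ ⟨n, rfl⟩
          rcases eq_or_ne n 0 with rfl | hn
          · simp
          · exact (min_le_left _ _).trans (hcon n hn)
        obtain ⟨n, hn, hlt⟩ := this
        filter_upwards [hs.eventually_div_lt_of_div_lt hn hlt] with p hp using hp.le
      refine (Real.tendsto_exp_atBot.comp ht).congr fun n => ?_
      simp only [Function.comp_apply]
      rw [Real.rpow_def_of_pos (hpos n), mul_one_div]

theorem tendsto_jointSpectralRadius (A : Tuple K r d) :
    Tendsto (fun n : ℕ => ⨆ w : Fin n → Fin r, ‖wordProd A w‖ ^ (1 / (n : ℝ)))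
      atTop (𝓝 (jointSpectralRadius A)) :=
  tendsto_nhds_limUnder (exists_tendsto A)

end MatrixTuple

end

/-!
The open set consists of tuples in which one matrix dominates all the others. Its base point has as
first matrix the orthogonal projection `E` onto the line of a unit vector, and small matrices
elsewhere. Three facts persist under perturbation.

* A matrix `M` near `E` splits as `M = lam • P + Q` with a rank one projection `P = vecMulVec u φ`,
  `P Q = Q P = 0`, `lam` near `1` and `Q` small (`eventually_exists_splitting`). The vectors `u` and
  `φ` are eigenvectors of `M` and of its transpose; they come from fixed points of contractions
  (`exists_eigenvector_near`).
* The other matrices are small compared with `lam`.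
* Certain products of the first two matrices are linearly independent, hence span all matrices,
  so the tuple is irreducible (`irred_of_linearIndependent`). At the base point this is the
  invertibility of a Vandermonde matrix (`linearIndependent_diagonal_products`).

The first two facts form the hypothesis `IsDominated`, from which everything else follows. In the
norm `splitNorm` adapted to `P`, multiplication by the dominant matrix expands by at most `‖lam‖`,
and multiplication by any other matrix by at most `‖lam‖ / 2`. Therefore the joint spectral radius
is `‖lam‖`, the spectral radius of the dominant matrix itself (`finitenessProperty`). A word with
many nondominant letters has a small normalized product, so a nonvanishing index sequence is
eventually constant (`eventually_eq_of_nonVanishing`), and any two of them agree on long blocks.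
A long word whose normalized product is not small contains a long block of the dominant letter, and
the corresponding power is nearly a multiple of `P`; so limits of normalized products have rank at
most one (`exists_splitNorm_sub_vecMulVec_le`).

For a Barabanov norm `B`, following letters along which `B` does not drop leads to a sequence that
ends in the dominant letter; along it the vector converges, up to phase, to a multiple of `u` that
is measured by `φ`. This gives `B v = B u * sup_w |φ (A_w v)| / ‖lam‖ ^ |w|` (`barabanovNorm_eq`).
The supremum does not depend on `B`, and it is itself a Barabanov norm when the tuple is
irreducible (`isBarabanovNorm_functionalSeminorm`).
-/

namespace MatrixTuple

variable {K : Type*} [RCLike K] {r d : ℕ}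

/-! ### Products along index sequences -/

/-- The product `A_{i(n-1)} ⋯ A_{i(0)}` of the first `n` matrices selected by an infinite index
sequence `i`. Every word is a prefix of such a sequence, so these are all the products. -/
def seqProd (A : Tuple K r d) (i : ℕ → Fin r) : ℕ → Matrix (Fin d) (Fin d) K
  | 0 => 1
  | n + 1 => A (i n) * seqProd A i n

@[simp] theorem seqProd_zero (A : Tuple K r d) (i : ℕ → Fin r) : seqProd A i 0 = 1 := rfl

theorem seqProd_succ (A : Tuple K r d) (i : ℕ → Fin r) (n : ℕ) :
    seqProd A i (n + 1) = A (i n) * seqProd A i n := rfl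

theorem seqProd_add (A : Tuple K r d) (i : ℕ → Fin r) (m n : ℕ) :
    seqProd A i (m + n) = seqProd A (fun k => i (m + k)) n * seqProd A i m := by
  induction n with
  | zero => simp
  | succ n ih => rw [← add_assoc, seqProd_succ, ih, seqProd_succ, mul_assoc]

theorem seqProd_succ' (A : Tuple K r d) (i : ℕ → Fin r) (n : ℕ) :
    seqProd A i (n + 1) = seqProd A (fun k => i (k + 1)) n * A (i 0) := by
  have h := seqProd_add A i 1 n
  simpa [add_comm 1, seqProd_succ] using h

theorem seqProd_const (A : Tuple K r d) (a : Fin r) (n : ℕ) :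
    seqProd A (fun _ => a) n = A a ^ n := by
  induction n with
  | zero => simp
  | succ n ih => rw [seqProd_succ, ih, pow_succ']

theorem seqProd_congr (A : Tuple K r d) {i j : ℕ → Fin r} {n : ℕ} (h : ∀ k < n, i k = j k) :
    seqProd A i n = seqProd A j n := by
  induction n with
  | zero => rfl
  | succ n ih =>
    rw [seqProd_succ, seqProd_succ, ih fun k hk => h k (by omega), h n (by omega)]

theorem seqProd_smul (A : Tuple K r d) (c : K) (i : ℕ → Fin r) (n : ℕ) :
    seqProd (fun k => c • A k) i n = c ^ n • seqProd A i n := by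
  induction n with
  | zero => simp
  | succ n ih => rw [seqProd_succ, seqProd_succ, ih, pow_succ', smul_mul_smul_comm]

theorem wordProd_eq_seqProd (A : Tuple K r d) (i : ℕ → Fin r) (n : ℕ) :
    wordProd A (fun k : Fin n => i k) = seqProd A i n := by
  induction n with
  | zero => simp [wordProd]
  | succ n ih =>
    rw [seqProd_succ, ← ih, wordProd, wordProd, List.ofFn_succ', List.concat_eq_append,
      List.reverse_append]
    simp

theorem exists_seqProd_eq_wordProd (A : Tuple K r d) (a : Fin r) {n : ℕ} (w : Fin n → Fin r) :
    ∃ i : ℕ → Fin r, seqProd A i n = wordProd A w := by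
  refine ⟨fun k => if h : k < n then w ⟨k, h⟩ else a, ?_⟩
  rw [← wordProd_eq_seqProd]
  congr 1
  funext k
  simp

/-! ### Tuples with a dominant matrix -/

/-- The matrix `A a` dominates the tuple `A`: it has the form `lam • P + Q` with a rank one
projection `P = vecMulVec u φ` that annihilates `Q` from both sides, `Q` is small compared with
the eigenvalue `lam`, and so are the other matrices of the tuple. -/
structure IsDominated (A : Tuple K r d) (a : Fin r) (lam : K) (u φ : Fin d → K)
    (Q : Matrix (Fin d) (Fin d) K) : Prop where
  eq_add : A a = lam • Matrix.vecMulVec u φ + Q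
  dotProduct_eq_one : φ ⬝ᵥ u = 1
  mulVec_eq_zero : Q *ᵥ u = 0
  vecMul_eq_zero : φ ᵥ* Q = 0
  ne_zero : lam ≠ 0
  norm_le : ‖Q‖ ≤ ‖lam‖ / 2
  norm_other_le : ∀ i, i ≠ a → (1 + 2 * ‖Matrix.vecMulVec u φ‖) * ‖A i‖ ≤ ‖lam‖ / 2

/-- The norm `‖P X‖ + ‖(1 - P) X‖` on matrices. When `P` is the dominant projection of a tuple,
left multiplication by the dominant matrix is nonexpanding up to the factor `‖lam‖`. -/
noncomputable def splitNorm (P X : Matrix (Fin d) (Fin d) K) : ℝ := ‖P * X‖ + ‖(1 - P) * X‖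

theorem splitNorm_nonneg (P X : Matrix (Fin d) (Fin d) K) : 0 ≤ splitNorm P X := by
  unfold splitNorm; positivity

theorem norm_le_splitNorm (P X : Matrix (Fin d) (Fin d) K) : ‖X‖ ≤ splitNorm P X := by
  have h : X = P * X + (1 - P) * X := by rw [sub_mul, one_mul]; abel
  calc ‖X‖ = ‖P * X + (1 - P) * X‖ := by rw [← h]
    _ ≤ _ := norm_add_le _ _

theorem splitNorm_le (P X : Matrix (Fin d) (Fin d) K) :
    splitNorm P X ≤ (1 + 2 * ‖P‖) * ‖X‖ := by
  have h1 := norm_mul_le P X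
  have h2 : ‖(1 - P) * X‖ ≤ ‖X‖ + ‖P * X‖ := by
    rw [sub_mul, one_mul]; exact norm_sub_le _ _
  unfold splitNorm
  linarith

namespace IsDominated

variable {A : Tuple K r d} {a : Fin r} {lam : K} {u φ : Fin d → K} {Q : Matrix (Fin d) (Fin d) K}

theorem norm_pos (h : IsDominated A a lam u φ Q) : 0 < ‖lam‖ := norm_pos_iff.2 h.ne_zero

theorem proj_mul_proj (h : IsDominated A a lam u φ Q) :
    Matrix.vecMulVec u φ * Matrix.vecMulVec u φ = Matrix.vecMulVec u φ := by
  rw [Matrix.vecMulVec_mul_vecMulVec, h.dotProduct_eq_one, one_smul]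

theorem proj_mul (h : IsDominated A a lam u φ Q) : Matrix.vecMulVec u φ * Q = 0 := by
  rw [Matrix.vecMulVec_mul, h.vecMul_eq_zero, Matrix.vecMulVec_zero]

theorem mul_proj (h : IsDominated A a lam u φ Q) : Q * Matrix.vecMulVec u φ = 0 := by
  rw [Matrix.mul_vecMulVec, h.mulVec_eq_zero, Matrix.zero_vecMulVec]

/-- For `n ≥ 1` the powers of the dominant matrix split along the projection. -/
theorem pow_succ_eq (h : IsDominated A a lam u φ Q) (n : ℕ) :
    A a ^ (n + 1) = lam ^ (n + 1) • Matrix.vecMulVec u φ + Q ^ (n + 1) := by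
  induction n with
  | zero => simpa using h.eq_add
  | succ n ih =>
    rw [pow_succ, ih, h.eq_add, add_mul, mul_add, mul_add, smul_mul_smul_comm, h.proj_mul_proj,
      smul_mul_assoc, h.proj_mul, pow_succ Q n, mul_smul_comm, mul_assoc _ Q (Matrix.vecMulVec u φ),
      h.mul_proj]
    simp [pow_succ]

theorem splitNorm_mul_le (h : IsDominated A a lam u φ Q) (X : Matrix (Fin d) (Fin d) K) :
    splitNorm (Matrix.vecMulVec u φ) (A a * X) ≤ ‖lam‖ * splitNorm (Matrix.vecMulVec u φ) X := by
  set P := Matrix.vecMulVec u φ with hP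
  have h1 : P * (A a * X) = lam • (P * X) := by
    rw [h.eq_add, ← mul_assoc, mul_add, mul_smul_comm, h.proj_mul_proj, h.proj_mul, add_zero,
      smul_mul_assoc]
  have h2 : (1 - P) * (A a * X) = Q * ((1 - P) * X) := by
    rw [sub_mul, h1, one_mul, h.eq_add, ← hP, ← mul_assoc, mul_sub, h.mul_proj, add_mul,
      smul_mul_assoc]
    simp
  have h3 := norm_mul_le Q ((1 - P) * X)
  have h4 : ‖Q‖ * ‖(1 - P) * X‖ ≤ ‖lam‖ * ‖(1 - P) * X‖ :=
    mul_le_mul_of_nonneg_right (by linarith [h.norm_le, h.norm_pos]) (norm_nonneg _)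
  unfold splitNorm
  rw [h1, h2, norm_smul]
  linarith

theorem splitNorm_mul_le_of_ne (h : IsDominated A a lam u φ Q) {i : Fin r} (hi : i ≠ a)
    (X : Matrix (Fin d) (Fin d) K) :
    splitNorm (Matrix.vecMulVec u φ) (A i * X) ≤
      ‖lam‖ / 2 * splitNorm (Matrix.vecMulVec u φ) X :=
  calc splitNorm (Matrix.vecMulVec u φ) (A i * X)
      ≤ (1 + 2 * ‖Matrix.vecMulVec u φ‖) * ‖A i * X‖ := splitNorm_le _ _
    _ ≤ (1 + 2 * ‖Matrix.vecMulVec u φ‖) * (‖A i‖ * ‖X‖) := by gcongr; exact norm_mul_le _ _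
    _ = (1 + 2 * ‖Matrix.vecMulVec u φ‖) * ‖A i‖ * ‖X‖ := by ring
    _ ≤ ‖lam‖ / 2 * splitNorm (Matrix.vecMulVec u φ) X :=
      mul_le_mul (h.norm_other_le i hi) (norm_le_splitNorm _ _) (norm_nonneg _) (by positivity)

theorem splitNorm_mul_le' (h : IsDominated A a lam u φ Q) (i : Fin r)
    (X : Matrix (Fin d) (Fin d) K) :
    splitNorm (Matrix.vecMulVec u φ) (A i * X) ≤ ‖lam‖ * splitNorm (Matrix.vecMulVec u φ) X := by
  by_cases hi : i = a
  · rw [hi]; exact h.splitNorm_mul_le X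
  · refine (h.splitNorm_mul_le_of_ne hi X).trans ?_
    exact mul_le_mul_of_nonneg_right (by linarith [h.norm_pos]) (splitNorm_nonneg _ _)

theorem splitNorm_seqProd_mul_le (h : IsDominated A a lam u φ Q) (i : ℕ → Fin r) (n : ℕ)
    (X : Matrix (Fin d) (Fin d) K) :
    splitNorm (Matrix.vecMulVec u φ) (seqProd A i n * X) ≤
      ‖lam‖ ^ n * splitNorm (Matrix.vecMulVec u φ) X := by
  induction n with
  | zero => simp
  | succ n ih =>
    rw [seqProd_succ, mul_assoc, pow_succ', mul_assoc]
    exact (h.splitNorm_mul_le' _ _).trans (by gcongr)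

theorem splitNorm_seqProd_le (h : IsDominated A a lam u φ Q) (i : ℕ → Fin r) (n : ℕ) :
    splitNorm (Matrix.vecMulVec u φ) (seqProd A i n) ≤
      ‖lam‖ ^ n * splitNorm (Matrix.vecMulVec u φ) 1 := by
  simpa using h.splitNorm_seqProd_mul_le i n 1

theorem norm_seqProd_le (h : IsDominated A a lam u φ Q) (i : ℕ → Fin r) (n : ℕ) :
    ‖seqProd A i n‖ ≤ ‖lam‖ ^ n * splitNorm (Matrix.vecMulVec u φ) 1 :=
  (norm_le_splitNorm _ _).trans (h.splitNorm_seqProd_le i n)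

theorem norm_wordProd_le (h : IsDominated A a lam u φ Q) {n : ℕ} (w : Fin n → Fin r) :
    ‖wordProd A w‖ ≤ ‖lam‖ ^ n * splitNorm (Matrix.vecMulVec u φ) 1 := by
  obtain ⟨i, hi⟩ := exists_seqProd_eq_wordProd A a w
  rw [← hi]
  exact h.norm_seqProd_le i n

theorem ne_zero_left (h : IsDominated A a lam u φ Q) : u ≠ 0 := by
  rintro rfl
  simpa using h.dotProduct_eq_one

theorem mulVec_eigenvector (h : IsDominated A a lam u φ Q) : A a *ᵥ u = lam • u := by
  rw [h.eq_add, Matrix.add_mulVec, Matrix.smul_mulVec, Matrix.vecMulVec_mulVec,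
    h.dotProduct_eq_one, h.mulVec_eq_zero]
  simp

theorem dotProduct_mulVec (h : IsDominated A a lam u φ Q) (v : Fin d → K) :
    φ ⬝ᵥ (A a *ᵥ v) = lam * (φ ⬝ᵥ v) := by
  rw [h.eq_add, Matrix.add_mulVec, Matrix.smul_mulVec, Matrix.vecMulVec_mulVec, dotProduct_add,
    Matrix.dotProduct_mulVec φ Q, h.vecMul_eq_zero]
  simp [h.dotProduct_eq_one]

theorem pow_mulVec_eigenvector (h : IsDominated A a lam u φ Q) (n : ℕ) :
    A a ^ n *ᵥ u = lam ^ n • u := by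
  induction n with
  | zero => simp
  | succ n ih =>
    rw [pow_succ, ← Matrix.mulVec_mulVec, h.mulVec_eigenvector, Matrix.mulVec_smul, ih, smul_smul,
      pow_succ, mul_comm]

theorem pow_le_norm_pow (h : IsDominated A a lam u φ Q) (n : ℕ) : ‖lam‖ ^ n ≤ ‖A a ^ n‖ := by
  have h1 := Matrix.l2_opNorm_mulVec (A a ^ n) (WithLp.toLp 2 u)
  have h2 : (A a ^ n) *ᵥ (WithLp.toLp 2 u).ofLp = lam ^ n • u := h.pow_mulVec_eigenvector n
  rw [h2] at h1
  have h3 : WithLp.toLp 2 (lam ^ n • u) = lam ^ n • WithLp.toLp 2 u := rfl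
  change ‖WithLp.toLp 2 (lam ^ n • u)‖ ≤ _ at h1
  rw [h3, norm_smul, norm_pow] at h1
  refine le_of_mul_le_mul_right h1 (norm_pos_iff.2 ?_)
  simpa using h.ne_zero_left

theorem splitNorm_one_pos (h : IsDominated A a lam u φ Q) :
    0 < splitNorm (Matrix.vecMulVec u φ) 1 := by
  have h1 := (h.pow_le_norm_pow 0).trans (by simpa using norm_le_splitNorm (Matrix.vecMulVec u φ) 1)
  simpa using lt_of_lt_of_le (by simp) h1

theorem jointSpectralRadius_eq (h : IsDominated A a lam u φ Q) :
    jointSpectralRadius A = ‖lam‖ := by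
  have hC := h.splitNorm_one_pos
  set C := splitNorm (Matrix.vecMulVec u φ) 1
  refine tendsto_nhds_unique (tendsto_jointSpectralRadius A) ?_
  have hup : Tendsto (fun n : ℕ => ‖lam‖ * C ^ (1 / (n : ℝ))) atTop (𝓝 ‖lam‖) := by
    have h1 : Tendsto (fun n : ℕ => C ^ (1 / (n : ℝ))) atTop (𝓝 (C ^ (0 : ℝ))) :=
      (Real.continuousAt_const_rpow hC.ne').tendsto.comp tendsto_one_div_atTop_nhds_zero_nat
    simpa using h1.const_mul ‖lam‖
  have hroot : ∀ n : ℕ, n ≠ 0 → (‖lam‖ ^ n) ^ (1 / (n : ℝ)) = ‖lam‖ := fun n hn => by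
    rw [one_div, Real.pow_rpow_inv_natCast (norm_nonneg _) hn]
  refine tendsto_of_tendsto_of_tendsto_of_le_of_le' tendsto_const_nhds hup ?_ ?_
  · filter_upwards [eventually_ne_atTop 0] with n hn
    rw [iSup_rpow_eq A hn, ← hroot n hn]
    refine Real.rpow_le_rpow (by positivity) ((h.pow_le_norm_pow n).trans ?_) (by positivity)
    rw [← seqProd_const, ← wordProd_eq_seqProd]
    exact le_maxNorm A _
  · filter_upwards [eventually_ne_atTop 0] with n hn
    rw [iSup_rpow_eq A hn]
    conv_rhs => rw [← hroot n hn]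
    rw [← Real.mul_rpow (by positivity) hC.le]
    refine Real.rpow_le_rpow (maxNorm_nonneg A n) ?_ (by positivity)
    have : Nonempty (Fin n → Fin r) := ⟨fun _ => a⟩
    exact ciSup_le fun w => h.norm_wordProd_le w

end IsDominated

/-! ### Vectors, entries and seminorms -/

theorem norm_mulVec_apply_le (M : Matrix (Fin d) (Fin d) K) (v : Fin d → K) (j : Fin d) :
    ‖(M *ᵥ v) j‖ ≤ ‖M‖ * ‖WithLp.toLp 2 v‖ :=
  (PiLp.norm_apply_le (WithLp.toLp 2 (M *ᵥ v)) j).trans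
    (Matrix.l2_opNorm_mulVec M (WithLp.toLp 2 v))

theorem exists_seminorm_mulVec_le (B : Seminorm K (Fin d → K)) (v : Fin d → K) :
    ∃ C : ℝ, 0 ≤ C ∧ ∀ M : Matrix (Fin d) (Fin d) K, B (M *ᵥ v) ≤ C * ‖M‖ := by
  refine ⟨∑ j, ‖WithLp.toLp 2 v‖ * B (Pi.single j 1),
    Finset.sum_nonneg fun j _ => mul_nonneg (norm_nonneg _) (apply_nonneg B _), fun M => ?_⟩
  have h1 : M *ᵥ v = ∑ j, (M *ᵥ v) j • (Pi.single j (1 : K) : Fin d → K) := by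
    exact pi_eq_sum_univ' (M *ᵥ v)
  calc B (M *ᵥ v) = B (∑ j, (M *ᵥ v) j • (Pi.single j (1 : K) : Fin d → K)) := by rw [← h1]
    _ ≤ ∑ j, B ((M *ᵥ v) j • (Pi.single j (1 : K) : Fin d → K)) :=
      Finset.le_sum_of_subadditive B (map_zero B).le (map_add_le_add B) _ _
    _ ≤ ∑ j, ‖WithLp.toLp 2 v‖ * B (Pi.single j 1) * ‖M‖ := by
      refine Finset.sum_le_sum fun j _ => ?_
      rw [map_smul_eq_mul]
      have h2 := mul_le_mul_of_nonneg_right (norm_mulVec_apply_le M v j)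
        (apply_nonneg B (Pi.single j (1 : K) : Fin d → K))
      linarith
    _ = _ := (Finset.sum_mul _ _ _).symm

/-! ### The spectral radius of the dominant matrix -/

/-- The embedding of `K` into `ℂ`, as a ring homomorphism. The underlying map is `RCLike.map K ℂ`, so
that mapping a matrix along either gives the same matrix by definition. -/
noncomputable def toComplex (K : Type*) [RCLike K] : K →+* ℂ where
  toFun := RCLike.map K ℂ
  map_one' := by simp
  map_mul' x y := by apply Complex.ext <;> simp
  map_zero' := by simp
  map_add' := map_add _

theorem norm_toComplex (x : K) : ‖toComplex K x‖ = ‖x‖ := by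
  have h : ‖toComplex K x‖ ^ 2 = ‖x‖ ^ 2 := by
    rw [← RCLike.normSq_eq_def', ← RCLike.normSq_eq_def', RCLike.normSq_apply, RCLike.normSq_apply]
    simp [toComplex]
  exact (pow_left_inj₀ (norm_nonneg _) (norm_nonneg _) two_ne_zero).1 h

theorem mem_spectrum_iff_exists_mulVec {M : Matrix (Fin d) (Fin d) ℂ} {z : ℂ} :
    z ∈ spectrum ℂ M ↔ ∃ v, v ≠ 0 ∧ M *ᵥ v = z • v := by
  rw [← Matrix.spectrum_toLin', ← Module.End.hasEigenvalue_iff_mem_spectrum]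
  constructor
  · intro h
    obtain ⟨v, hv⟩ := h.exists_hasEigenvector
    exact ⟨v, hv.2, by simpa using hv.apply_eq_smul⟩
  · rintro ⟨v, hv, h⟩
    exact Module.End.hasEigenvalue_of_hasEigenvector
      (Module.End.hasEigenvector_iff.2 ⟨Module.End.mem_eigenspace_iff.2 (by simpa using h), hv⟩)

/-- If the powers of `M` grow at most like `c ^ n`, then every complex eigenvalue of `M` has
modulus at most `c`. -/
theorem norm_le_of_mem_spectrum {M : Matrix (Fin d) (Fin d) K} {c C : ℝ} (hc : 0 < c)
    (hM : ∀ n, ‖M ^ n‖ ≤ c ^ n * C) {z : ℂ}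
    (hz : z ∈ spectrum ℂ (M.map (toComplex K))) : ‖z‖ ≤ c := by
  obtain ⟨v, hv, hvz⟩ := mem_spectrum_iff_exists_mulVec.1 hz
  obtain ⟨j, hj⟩ := Function.ne_iff.1 hv
  have hpow : ∀ n, (M ^ n).map (toComplex K) *ᵥ v = z ^ n • v := by
    intro n
    induction n with
    | zero => simp [Matrix.map_one]
    | succ n ih =>
      rw [pow_succ, Matrix.map_mul, ← Matrix.mulVec_mulVec, hvz, Matrix.mulVec_smul, ih, smul_smul,
        pow_succ, mul_comm]
  have hentry : ∀ n k, ‖(M ^ n) j k‖ ≤ ‖M ^ n‖ := fun n k => by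
    have h := norm_mulVec_apply_le (M ^ n) (Pi.single k 1) j
    simpa using h
  have hbound : ∀ n, (‖z‖ / c) ^ n ≤ C * (∑ k, ‖v k‖) / ‖v j‖ := by
    intro n
    have hj' : 0 < ‖v j‖ := norm_pos_iff.2 hj
    rw [div_pow, div_le_div_iff₀ (by positivity) hj']
    calc ‖z‖ ^ n * ‖v j‖ = ‖((M ^ n).map (toComplex K) *ᵥ v) j‖ := by rw [hpow]; simp
      _ ≤ ∑ k, ‖(M ^ n) j k‖ * ‖v k‖ := by
        rw [Matrix.mulVec, dotProduct]
        refine (norm_sum_le _ _).trans (Finset.sum_le_sum fun k _ => ?_)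
        rw [norm_mul, Matrix.map_apply, norm_toComplex]
      _ ≤ ∑ k, (c ^ n * C) * ‖v k‖ := by
        refine Finset.sum_le_sum fun k _ => ?_
        exact mul_le_mul_of_nonneg_right ((hentry n k).trans (hM n)) (norm_nonneg _)
      _ = C * (∑ k, ‖v k‖) * c ^ n := by rw [← Finset.mul_sum]; ring
  by_contra! hlt
  have h1 : 1 < ‖z‖ / c := (one_lt_div hc).2 hlt
  obtain ⟨n, hn⟩ := pow_unbounded_of_one_lt (C * (∑ k, ‖v k‖) / ‖v j‖) h1
  exact absurd (hbound n) (not_le.2 hn)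

namespace IsDominated

variable {A : Tuple K r d} {a : Fin r} {lam : K} {u φ : Fin d → K} {Q : Matrix (Fin d) (Fin d) K}

theorem specRadius_eq (h : IsDominated A a lam u φ Q) : specRadius (A a) = ‖lam‖ := by
  have hmap : (A a).map (RCLike.map K ℂ) = (A a).map (toComplex K) := rfl
  have hmem : toComplex K lam ∈ spectrum ℂ ((A a).map (toComplex K)) := by
    refine mem_spectrum_iff_exists_mulVec.2 ⟨fun k => toComplex K (u k), ?_, ?_⟩
    · intro h0
      refine h.ne_zero_left (funext fun k => ?_)
      have := congrFun h0 k
      simpa using this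
    · funext k
      have h1 := congrArg (toComplex K) (congrFun h.mulVec_eigenvector k)
      rw [RingHom.map_mulVec] at h1
      simpa [Function.comp_def] using h1
  have hsr : spectralRadius ℂ ((A a).map (toComplex K)) = (‖lam‖₊ : ENNReal) := by
    apply le_antisymm
    · refine iSup₂_le fun z hz => ?_
      have := norm_le_of_mem_spectrum (C := splitNorm (Matrix.vecMulVec u φ) 1) h.norm_pos
        (fun n => by rw [← seqProd_const]; exact h.norm_seqProd_le _ n) hz
      exact_mod_cast this
    · have h1 : (‖toComplex K lam‖₊ : ENNReal) ≤ spectralRadius ℂ ((A a).map (toComplex K)) :=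
        le_iSup₂ (f := fun (z : ℂ) (_ : z ∈ spectrum ℂ ((A a).map (toComplex K))) =>
          (‖z‖₊ : ENNReal)) _ hmem
      have h2 : ‖toComplex K lam‖₊ = ‖lam‖₊ := NNReal.eq (norm_toComplex lam)
      rwa [h2] at h1
  rw [specRadius, hmap, hsr]
  simp

theorem finitenessProperty (h : IsDominated A a lam u φ Q) : FinitenessProperty A := by
  refine ⟨1, le_rfl, fun _ => a, ?_⟩
  have h1 : wordProd A (fun _ : Fin 1 => a) = A a := by simp [wordProd]
  rw [h1, h.specRadius_eq, h.jointSpectralRadius_eq]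
  simp

/-! ### Index sequences that leave the dominant letter infinitely often -/

/-- Each letter other than the dominant one costs a factor `1 / 2`. -/
theorem exists_splitNorm_seqProd_le (h : IsDominated A a lam u φ Q) {i : ℕ → Fin r}
    (hi : ∀ m, ∃ n ≥ m, i n ≠ a) (k : ℕ) :
    ∃ m, ∀ n ≥ m, splitNorm (Matrix.vecMulVec u φ) (seqProd A i n) ≤
      ‖lam‖ ^ n * (splitNorm (Matrix.vecMulVec u φ) 1 * (1 / 2) ^ k) := by
  induction k with
  | zero => exact ⟨0, fun n _ => by simpa using h.splitNorm_seqProd_le i n⟩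
  | succ k ih =>
    obtain ⟨m, hm⟩ := ih
    obtain ⟨j, hj, hja⟩ := hi m
    refine ⟨j + 1, fun n hn => ?_⟩
    obtain ⟨l, rfl⟩ := Nat.exists_eq_add_of_le hn
    rw [seqProd_add, seqProd_succ]
    refine (h.splitNorm_seqProd_mul_le _ _ _).trans ?_
    calc _ ≤ ‖lam‖ ^ l * (‖lam‖ / 2 * (‖lam‖ ^ j *
          (splitNorm (Matrix.vecMulVec u φ) 1 * (1 / 2) ^ k))) := by
            refine mul_le_mul_of_nonneg_left ((h.splitNorm_mul_le_of_ne hja _).trans ?_)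
              (by positivity)
            exact mul_le_mul_of_nonneg_left (hm j hj) (by positivity)
      _ = _ := by ring

theorem tendsto_norm_seqProd_div (h : IsDominated A a lam u φ Q) {i : ℕ → Fin r}
    (hi : ∀ m, ∃ n ≥ m, i n ≠ a) :
    Tendsto (fun n => ‖seqProd A i n‖ / ‖lam‖ ^ n) atTop (𝓝 0) := by
  have hρ := h.norm_pos
  rw [Metric.tendsto_atTop]
  intro ε hε
  have ht : Tendsto (fun k : ℕ => splitNorm (Matrix.vecMulVec u φ) 1 * (1 / 2 : ℝ) ^ k)
      atTop (𝓝 0) := by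
    simpa using (tendsto_pow_atTop_nhds_zero_of_lt_one (by norm_num : (0 : ℝ) ≤ 1 / 2)
      (by norm_num)).const_mul (splitNorm (Matrix.vecMulVec u φ) 1)
  obtain ⟨k, hk⟩ := (ht.eventually_lt_const hε).exists
  obtain ⟨m, hm⟩ := h.exists_splitNorm_seqProd_le hi k
  refine ⟨m, fun n hn => ?_⟩
  rw [Real.dist_0_eq_abs, abs_of_nonneg (by positivity), div_lt_iff₀ (by positivity)]
  calc ‖seqProd A i n‖ ≤ _ := (norm_le_splitNorm _ _).trans (hm n hn)
    _ < ε * ‖lam‖ ^ n := by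
      rw [mul_comm]
      exact mul_lt_mul_of_pos_right hk (by positivity)

theorem eventually_eq_of_nonVanishing (h : IsDominated A a lam u φ Q) {i : ℕ → Fin r}
    (hi : NonVanishing A i) : ∃ m, ∀ n ≥ m, i n = a := by
  by_contra! hcon
  have h1 := h.tendsto_norm_seqProd_div hcon
  have h2 : Tendsto (fun n : ℕ =>
      ((‖wordProd A fun k : Fin n => i k‖ / jointSpectralRadius A ^ n : ℝ) : EReal)) atTop
      (𝓝 ((0 : ℝ) : EReal)) := by
    simp only [wordProd_eq_seqProd, h.jointSpectralRadius_eq]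
    exact (continuous_coe_real_ereal.tendsto 0).comp h1
  rw [NonVanishing, h2.limsup_eq] at hi
  simp at hi

theorem unboundedAgreements (h : IsDominated A a lam u φ Q) : UnboundedAgreements A := by
  intro N i j hi hj
  obtain ⟨m, hm⟩ := h.eventually_eq_of_nonVanishing hi
  obtain ⟨n, hn⟩ := h.eventually_eq_of_nonVanishing hj
  exact ⟨m + 1, n + 1, by omega, by omega, fun k _ => by
    rw [hm _ (by omega), hn _ (by omega)]⟩

/-! ### The rank one property -/

theorem relativelyProductBounded (h : IsDominated A a lam u φ Q) :
    RelativelyProductBounded A := by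
  have hρ := h.norm_pos
  refine ⟨by rw [h.jointSpectralRadius_eq]; exact hρ, ?_⟩
  rw [h.jointSpectralRadius_eq, ProductBounded, isBounded_iff_forall_norm_le]
  refine ⟨splitNorm (Matrix.vecMulVec u φ) 1, fun M hM => ?_⟩
  simp only [Set.mem_iUnion] at hM
  obtain ⟨n, -, w, rfl⟩ := hM
  obtain ⟨i, hi⟩ := exists_seqProd_eq_wordProd (fun i => ‖lam‖⁻¹ • A i) a w
  have h1 : (fun i => ‖lam‖⁻¹ • A i) = fun i => ((‖lam‖⁻¹ : ℝ) : K) • A i := by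
    funext i
    exact RCLike.real_smul_eq_coe_smul (K := K) _ _
  change ‖wordProd _ w‖ ≤ _
  rw [← hi, h1, seqProd_smul, norm_smul, norm_pow, RCLike.norm_ofReal, abs_of_pos (by positivity),
    inv_pow, inv_mul_le_iff₀ (by positivity)]
  exact h.norm_seqProd_le i n

/-- Long normalized products are close to matrices of rank at most one. If the last `k + 1` letters
are all dominant, then they contribute a rank one matrix up to an error `2 ^ -(k + 1)`; otherwise
some other letter among them improves an earlier approximation by the factor `1 / 2`. -/
theorem exists_splitNorm_sub_vecMulVec_le (h : IsDominated A a lam u φ Q) (k : ℕ) :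
    ∃ m, ∀ n ≥ m, ∀ i : ℕ → Fin r, ∃ x y : Fin d → K,
      splitNorm (Matrix.vecMulVec u φ) (seqProd A i n - Matrix.vecMulVec x y) ≤
        ‖lam‖ ^ n * (splitNorm (Matrix.vecMulVec u φ) 1 * (1 / 2) ^ k) := by
  induction k with
  | zero => exact ⟨0, fun n _ i => ⟨0, 0, by simpa using h.splitNorm_seqProd_le i n⟩⟩
  | succ k ih =>
    obtain ⟨m, hm⟩ := ih
    refine ⟨m + (k + 1), fun n hn i => ?_⟩
    by_cases hcase : ∃ j, n - (k + 1) ≤ j ∧ j < n ∧ i j ≠ a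
    · obtain ⟨j, hj, hjn, hja⟩ := hcase
      obtain ⟨l, rfl⟩ := Nat.exists_eq_add_of_lt hjn
      obtain ⟨x, y, hxy⟩ := hm j (by omega) i
      set Y := seqProd A (fun t => i (j + 1 + t)) l
      refine ⟨(Y * A (i j)) *ᵥ x, y, ?_⟩
      have h1 : seqProd A i (j + l + 1) - Matrix.vecMulVec ((Y * A (i j)) *ᵥ x) y =
          Y * (A (i j) * (seqProd A i j - Matrix.vecMulVec x y)) := by
        rw [add_right_comm, seqProd_add, seqProd_succ, ← Matrix.mul_vecMulVec, mul_sub, mul_sub,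
          mul_assoc]
      rw [h1]
      refine (h.splitNorm_seqProd_mul_le _ _ _).trans ?_
      calc _ ≤ ‖lam‖ ^ l * (‖lam‖ / 2 * (‖lam‖ ^ j *
            (splitNorm (Matrix.vecMulVec u φ) 1 * (1 / 2) ^ k))) := by
              refine mul_le_mul_of_nonneg_left ((h.splitNorm_mul_le_of_ne hja _).trans ?_)
                (by positivity)
              exact mul_le_mul_of_nonneg_left hxy (by positivity)
        _ = _ := by ring
    · push Not at hcase
      obtain ⟨l, rfl⟩ := Nat.exists_eq_add_of_le (show k + 1 ≤ n by omega)
      rw [add_comm (k + 1) l]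
      have h1 : seqProd A i (l + (k + 1)) = A a ^ (k + 1) * seqProd A i l := by
        rw [seqProd_add, ← seqProd_const]
        congr 1
        exact seqProd_congr A fun t ht => hcase _ (by omega) (by omega)
      refine ⟨lam ^ (k + 1) • u, φ ᵥ* seqProd A i l, ?_⟩
      have h2 : seqProd A i (l + (k + 1)) -
          Matrix.vecMulVec (lam ^ (k + 1) • u) (φ ᵥ* seqProd A i l) =
          Q ^ (k + 1) * seqProd A i l := by
        rw [h1, h.pow_succ_eq, add_mul, smul_mul_assoc, Matrix.vecMulVec_mul,
          Matrix.smul_vecMulVec, add_sub_cancel_left]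
      have h3 : Matrix.vecMulVec u φ * (Q ^ (k + 1) * seqProd A i l) = 0 := by
        rw [pow_succ', ← mul_assoc, ← mul_assoc, h.proj_mul, zero_mul, zero_mul]
      have h4 : (1 - Matrix.vecMulVec u φ) * (Q ^ (k + 1) * seqProd A i l) =
          Q ^ (k + 1) * ((1 - Matrix.vecMulVec u φ) * seqProd A i l) := by
        rw [sub_mul, h3, sub_mul, mul_sub, ← mul_assoc _ (Matrix.vecMulVec u φ), pow_succ,
          mul_assoc _ Q (Matrix.vecMulVec u φ), h.mul_proj]
        simp
      rw [h2, splitNorm, h3, h4, norm_zero, zero_add]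
      calc ‖Q ^ (k + 1) * ((1 - Matrix.vecMulVec u φ) * seqProd A i l)‖
          ≤ ‖Q ^ (k + 1)‖ * ‖(1 - Matrix.vecMulVec u φ) * seqProd A i l‖ := norm_mul_le _ _
        _ ≤ (‖lam‖ / 2) ^ (k + 1) * (‖lam‖ ^ l * splitNorm (Matrix.vecMulVec u φ) 1) := by
          refine mul_le_mul ((norm_pow_le' Q k.succ_pos).trans
            (pow_le_pow_left₀ (norm_nonneg _) h.norm_le _)) ?_ (norm_nonneg _) (by positivity)
          refine le_trans ?_ (h.splitNorm_seqProd_le i l)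
          exact le_add_of_nonneg_left (norm_nonneg _)
        _ = _ := by rw [div_eq_mul_one_div, mul_pow]; ring

end IsDominated

/-- Limits of matrices of rank at most one have rank at most one, because the vanishing of all
`2 × 2` minors is a closed condition. -/
theorem rank_le_one_of_mem_closure {M : Matrix (Fin d) (Fin d) K}
    (hM : M ∈ closure {R | ∃ x y : Fin d → K, R = Matrix.vecMulVec x y}) : M.rank ≤ 1 := by
  have hclosed : IsClosed {R : Matrix (Fin d) (Fin d) K |
      ∀ i j k l, R i j * R k l = R i l * R k j} := by
    simp only [Set.ofPred_forall]
    refine isClosed_iInter fun i => isClosed_iInter fun j => isClosed_iInter fun k =>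
      isClosed_iInter fun l => isClosed_eq ?_ ?_ <;> fun_prop
  have hmin : ∀ i j k l, M i j * M k l = M i l * M k j := by
    refine closure_minimal ?_ hclosed hM
    rintro _ ⟨x, y, rfl⟩ i j k l
    simp only [Matrix.vecMulVec_apply]
    ring
  by_cases h0 : M = 0
  · simp [h0]
  · obtain ⟨k, l, hkl⟩ : ∃ k l, M k l ≠ 0 := by
      by_contra! hcon
      exact h0 (Matrix.ext hcon)
    have h1 : M = Matrix.vecMulVec (fun i => M i l) fun j => M k j / M k l := by
      ext i j
      rw [Matrix.vecMulVec_apply, ← mul_div_assoc, eq_div_iff hkl, hmin]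
    rw [h1]
    exact Matrix.rank_vecMulVec_le _ _

namespace IsDominated

variable {A : Tuple K r d} {a : Fin r} {lam : K} {u φ : Fin d → K} {Q : Matrix (Fin d) (Fin d) K}

theorem rankOneProperty (h : IsDominated A a lam u φ Q) : RankOneProperty A := by
  refine ⟨h.relativelyProductBounded, fun M hM hM0 => le_antisymm ?_ ?_⟩
  · have hρ := h.norm_pos
    refine rank_le_one_of_mem_closure (Metric.mem_closure_iff.2 fun ε hε => ?_)
    have ht : Tendsto (fun k : ℕ => splitNorm (Matrix.vecMulVec u φ) 1 * (1 / 2 : ℝ) ^ k)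
        atTop (𝓝 0) := by
      simpa using (tendsto_pow_atTop_nhds_zero_of_lt_one (by norm_num : (0 : ℝ) ≤ 1 / 2)
        (by norm_num)).const_mul (splitNorm (Matrix.vecMulVec u φ) 1)
    obtain ⟨k, hk⟩ := (ht.eventually_lt_const (half_pos hε)).exists
    obtain ⟨m, hm⟩ := h.exists_splitNorm_sub_vecMulVec_le k
    rw [limitSemigroup, Set.mem_iInter₂] at hM
    obtain ⟨X, hX, hMX⟩ := Metric.mem_closure_iff.1 (hM (m + 1) (by omega)) _ (half_pos hε)
    simp only [Set.mem_iUnion] at hX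
    obtain ⟨n, hn, _, ⟨w, rfl⟩, rfl⟩ := hX
    obtain ⟨i, hi⟩ := exists_seqProd_eq_wordProd A a w
    obtain ⟨x, y, hxy⟩ := hm n (by omega) i
    simp only [h.jointSpectralRadius_eq, ← hi] at hMX
    rw [RCLike.real_smul_eq_coe_smul (K := K)] at hMX
    set c : K := (((‖lam‖ ^ n)⁻¹ : ℝ) : K) with hc
    have hcn : ‖c‖ = (‖lam‖ ^ n)⁻¹ := by
      rw [hc, RCLike.norm_ofReal, abs_of_pos (by positivity)]
    refine ⟨Matrix.vecMulVec (c • x) y, ⟨_, _, rfl⟩, ?_⟩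
    have h1 : dist (c • seqProd A i n) (Matrix.vecMulVec (c • x) y) < ε / 2 := by
      rw [dist_eq_norm, Matrix.smul_vecMulVec, ← smul_sub, norm_smul, hcn,
        inv_mul_lt_iff₀ (by positivity)]
      refine ((norm_le_splitNorm _ _).trans hxy).trans_lt ?_
      exact mul_lt_mul_of_pos_left hk (by positivity)
    linarith [dist_triangle M (c • seqProd A i n) (Matrix.vecMulVec (c • x) y)]
  · refine Nat.one_le_iff_ne_zero.2 fun h0 => hM0 ?_
    rw [Matrix.rank, Submodule.finrank_eq_zero, LinearMap.range_eq_bot] at h0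
    exact Matrix.toLin'.injective (by rw [Matrix.toLin'_apply', h0, map_zero])

end IsDominated

/-! ### The Barabanov norm -/

namespace IsDominated

variable {A : Tuple K r d} {a : Fin r} {lam : K} {u φ : Fin d → K} {Q : Matrix (Fin d) (Fin d) K}

theorem bddAbove_functional (h : IsDominated A a lam u φ Q) (v : Fin d → K) :
    BddAbove (Set.range fun p : ℕ × (ℕ → Fin r) =>
      ‖φ ⬝ᵥ (seqProd A p.2 p.1 *ᵥ v)‖ / ‖lam‖ ^ p.1) := by
  have hρ := h.norm_pos
  refine ⟨∑ j, ‖φ j‖ * (splitNorm (Matrix.vecMulVec u φ) 1 * ‖WithLp.toLp 2 v‖), ?_⟩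
  rintro _ ⟨⟨n, i⟩, rfl⟩
  rw [div_le_iff₀ (by positivity), Finset.sum_mul]
  refine (norm_sum_le _ _).trans (Finset.sum_le_sum fun j _ => ?_)
  rw [norm_mul, mul_assoc]
  refine mul_le_mul_of_nonneg_left ((norm_mulVec_apply_le _ v j).trans ?_) (norm_nonneg _)
  calc ‖seqProd A i n‖ * ‖WithLp.toLp 2 v‖
      ≤ (‖lam‖ ^ n * splitNorm (Matrix.vecMulVec u φ) 1) * ‖WithLp.toLp 2 v‖ :=
        mul_le_mul_of_nonneg_right (h.norm_seqProd_le i n) (norm_nonneg _)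
    _ = _ := by ring

/-- The seminorm `v ↦ sup_w |φ(A_w v)| / ‖lam‖ ^ |w|`, the supremum being over all words `w`. It is
a Barabanov norm as soon as the tuple is irreducible. -/
noncomputable def functionalSeminorm (h : IsDominated A a lam u φ Q) :
    Seminorm K (Fin d → K) :=
  Seminorm.of
    (fun v => ⨆ p : ℕ × (ℕ → Fin r), ‖φ ⬝ᵥ (seqProd A p.2 p.1 *ᵥ v)‖ / ‖lam‖ ^ p.1)
    (fun v w => by
      have : Nonempty (ℕ × (ℕ → Fin r)) := ⟨(0, fun _ => a)⟩
      refine ciSup_le fun p => ?_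
      refine le_trans ?_ (add_le_add (le_ciSup (h.bddAbove_functional v) p)
        (le_ciSup (h.bddAbove_functional w) p))
      rw [Matrix.mulVec_add, dotProduct_add, ← add_div]
      exact div_le_div_of_nonneg_right (norm_add_le _ _) (by positivity))
    (fun c v => by
      rw [Real.mul_iSup_of_nonneg (norm_nonneg _)]
      refine congrArg iSup (funext fun p => ?_)
      rw [Matrix.mulVec_smul, dotProduct_smul, norm_smul, mul_div_assoc])

theorem le_functionalSeminorm (h : IsDominated A a lam u φ Q) (i : ℕ → Fin r) (n : ℕ)
    (v : Fin d → K) :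
    ‖φ ⬝ᵥ (seqProd A i n *ᵥ v)‖ / ‖lam‖ ^ n ≤ h.functionalSeminorm v :=
  le_ciSup (h.bddAbove_functional v) (n, i)

theorem functionalSeminorm_le (h : IsDominated A a lam u φ Q) {v : Fin d → K} {c : ℝ}
    (hc : ∀ (i : ℕ → Fin r) (n : ℕ), ‖φ ⬝ᵥ (seqProd A i n *ᵥ v)‖ / ‖lam‖ ^ n ≤ c) :
    h.functionalSeminorm v ≤ c :=
  have : Nonempty (ℕ × (ℕ → Fin r)) := ⟨(0, fun _ => a)⟩
  ciSup_le fun p => hc p.2 p.1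

theorem functionalSeminorm_mulVec_le (h : IsDominated A a lam u φ Q) (b : Fin r)
    (v : Fin d → K) :
    h.functionalSeminorm (A b *ᵥ v) ≤ ‖lam‖ * h.functionalSeminorm v := by
  have hρ := h.norm_pos
  refine h.functionalSeminorm_le fun i n => ?_
  have h1 := h.le_functionalSeminorm (fun k => Nat.casesOn k b i) (n + 1) v
  rw [seqProd_succ', ← Matrix.mulVec_mulVec] at h1
  rw [div_le_iff₀ (by positivity)] at h1 ⊢
  calc _ ≤ _ := h1
    _ = _ := by ring

theorem isBarabanovNorm_functionalSeminorm (h : IsDominated A a lam u φ Q) (hA : Irred A) :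
    IsBarabanovNorm A h.functionalSeminorm := by
  have hρ := h.norm_pos
  constructor
  · intro v hv
    -- The common kernel of the functionals `φ ∘ A_w` is invariant, and it does not contain `u`.
    let V : Submodule K (Fin d → K) :=
      { carrier := {w | ∀ (i : ℕ → Fin r) (n : ℕ), φ ⬝ᵥ (seqProd A i n *ᵥ w) = 0}
        add_mem' := fun {x y} hx hy i n => by
          rw [Matrix.mulVec_add, dotProduct_add, hx, hy, add_zero]
        zero_mem' := fun i n => by simp
        smul_mem' := fun c x hx i n => by
          rw [Matrix.mulVec_smul, dotProduct_smul, hx, smul_zero] }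
    have hV : ∀ i, ∀ w ∈ V, A i *ᵥ w ∈ V := by
      intro b w hw i n
      have h1 := hw (fun k => Nat.casesOn k b i) (n + 1)
      rwa [seqProd_succ', ← Matrix.mulVec_mulVec] at h1
    have hvV : v ∈ V := by
      intro i n
      have h1 := h.le_functionalSeminorm i n v
      rw [hv, div_le_iff₀ (by positivity), zero_mul] at h1
      exact norm_le_zero_iff.1 h1
    rcases hA V hV with h0 | h0
    · rw [h0] at hvV
      exact (Submodule.mem_bot K).1 hvV
    · have hu : u ∈ V := by rw [h0]; trivial
      have h1 := hu (fun _ => a) 0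
      rw [seqProd_zero, Matrix.one_mulVec, h.dotProduct_eq_one] at h1
      exact absurd h1 one_ne_zero
  · intro v
    rw [h.jointSpectralRadius_eq]
    have : Nonempty (Fin r) := ⟨a⟩
    obtain ⟨b, hb⟩ := Finite.exists_max fun b => h.functionalSeminorm (A b *ᵥ v)
    refine ⟨⟨b, le_antisymm (h.functionalSeminorm_mulVec_le b v) ?_⟩, ?_⟩
    · rw [← le_div_iff₀' hρ]
      refine h.functionalSeminorm_le fun i n => ?_
      rw [le_div_iff₀ hρ]
      -- The empty word may be replaced by the dominant letter.
      cases n with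
      | zero =>
        refine le_trans ?_ (hb a)
        have h1 := h.le_functionalSeminorm i 0 (A a *ᵥ v)
        simp only [seqProd_zero, Matrix.one_mulVec, pow_zero, div_one, h.dotProduct_mulVec,
          norm_mul] at h1 ⊢
        linarith
      | succ n =>
        refine le_trans ?_ (hb (i 0))
        have h1 := h.le_functionalSeminorm (fun k => i (k + 1)) n (A (i 0) *ᵥ v)
        rw [Matrix.mulVec_mulVec, ← seqProd_succ'] at h1
        refine le_trans (le_of_eq ?_) h1
        field_simp
        ring
    · rintro _ ⟨b, rfl⟩
      exact h.functionalSeminorm_mulVec_le b v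

theorem seminorm_seqProd_le (h : IsDominated A a lam u φ Q) {B : Seminorm K (Fin d → K)}
    (hB : IsBarabanovNorm A B) (i : ℕ → Fin r) (n : ℕ) (v : Fin d → K) :
    B (seqProd A i n *ᵥ v) ≤ ‖lam‖ ^ n * B v := by
  induction n with
  | zero => simp
  | succ n ih =>
    have h1 := (hB.2 (seqProd A i n *ᵥ v)).2 ⟨i n, rfl⟩
    rw [h.jointSpectralRadius_eq] at h1
    rw [seqProd_succ, ← Matrix.mulVec_mulVec, pow_succ', mul_assoc]
    exact h1.trans (mul_le_mul_of_nonneg_left ih (norm_nonneg _))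

theorem pow_mulVec (h : IsDominated A a lam u φ Q) (n : ℕ) (v : Fin d → K) :
    A a ^ (n + 1) *ᵥ v = (lam ^ (n + 1) * (φ ⬝ᵥ v)) • u + Q ^ (n + 1) *ᵥ v := by
  rw [h.pow_succ_eq, Matrix.add_mulVec, Matrix.smul_mulVec, Matrix.vecMulVec_mulVec]
  simp [smul_smul]

/-- Since `A a ^ n v / lam ^ n` converges to `(φ ⬝ᵥ v) • u`, so do its values under any seminorm. -/
theorem tendsto_seminorm_pow (h : IsDominated A a lam u φ Q) (B : Seminorm K (Fin d → K))
    (v : Fin d → K) :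
    Tendsto (fun n => B (A a ^ (n + 1) *ᵥ v) / ‖lam‖ ^ (n + 1)) atTop
      (𝓝 (‖φ ⬝ᵥ v‖ * B u)) := by
  have hρ := h.norm_pos
  obtain ⟨C, hC, hBC⟩ := exists_seminorm_mulVec_le B v
  have hQ : ∀ n, B (Q ^ (n + 1) *ᵥ v) ≤ ‖lam‖ ^ (n + 1) * (C * (1 / 2) ^ (n + 1)) := fun n =>
    calc B (Q ^ (n + 1) *ᵥ v) ≤ C * ‖Q ^ (n + 1)‖ := hBC _
      _ ≤ C * (‖lam‖ / 2) ^ (n + 1) := by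
        refine mul_le_mul_of_nonneg_left ?_ hC
        exact (norm_pow_le' Q n.succ_pos).trans (pow_le_pow_left₀ (norm_nonneg _) h.norm_le _)
      _ = _ := by rw [div_eq_mul_one_div, mul_pow]; ring
  have h0 : Tendsto (fun n : ℕ => C * (1 / 2 : ℝ) ^ (n + 1)) atTop (𝓝 0) := by
    simpa using ((tendsto_add_atTop_iff_nat 1).2 (tendsto_pow_atTop_nhds_zero_of_lt_one
      (by norm_num : (0 : ℝ) ≤ 1 / 2) (by norm_num))).const_mul C
  rw [tendsto_iff_dist_tendsto_zero]
  refine squeeze_zero (fun _ => dist_nonneg) (fun n => ?_) h0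
  have h1 : B ((lam ^ (n + 1) * (φ ⬝ᵥ v)) • u) = ‖lam‖ ^ (n + 1) * (‖φ ⬝ᵥ v‖ * B u) := by
    rw [map_smul_eq_mul, norm_mul, norm_pow, mul_assoc]
  have h2 := abs_sub_map_le_sub B (A a ^ (n + 1) *ᵥ v) ((lam ^ (n + 1) * (φ ⬝ᵥ v)) • u)
  rw [h.pow_mulVec, add_sub_cancel_left, ← h.pow_mulVec, h1] at h2
  have h3 : B (A a ^ (n + 1) *ᵥ v) / ‖lam‖ ^ (n + 1) - ‖φ ⬝ᵥ v‖ * B u =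
      (B (A a ^ (n + 1) *ᵥ v) - ‖lam‖ ^ (n + 1) * (‖φ ⬝ᵥ v‖ * B u)) / ‖lam‖ ^ (n + 1) := by
    field_simp
  rw [Real.dist_eq, h3, abs_div, abs_of_pos (pow_pos hρ (n + 1)), div_le_iff₀ (by positivity)]
  refine (h2.trans (hQ n)).trans (le_of_eq (mul_comm _ _))

/-- Every Barabanov norm is a multiple of the functional seminorm. An index sequence along which
the Barabanov norm of `v` never drops must end in the dominant letter, so that the norm of `v` is
read off from the functional `φ`. -/
theorem barabanovNorm_eq (h : IsDominated A a lam u φ Q) {B : Seminorm K (Fin d → K)}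
    (hB : IsBarabanovNorm A B) (v : Fin d → K) : B v = B u * h.functionalSeminorm v := by
  have hρ := h.norm_pos
  have hBu : 0 < B u := lt_of_le_of_ne (apply_nonneg B u)
    fun h0 => h.ne_zero_left (hB.1 u h0.symm)
  apply le_antisymm
  · rcases eq_or_ne v 0 with rfl | hv
    · simp
    have hBv : 0 < B v := lt_of_le_of_ne (apply_nonneg B v) fun h0 => hv (hB.1 v h0.symm)
    have hstep : ∀ w, ∃ b, B (A b *ᵥ w) = ‖lam‖ * B w := fun w => by
      have := (hB.2 w).1
      rwa [h.jointSpectralRadius_eq] at this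
    choose b hb using hstep
    let x : ℕ → Fin d → K := fun n => Nat.rec v (fun _ w => A (b w) *ᵥ w) n
    let i : ℕ → Fin r := fun n => b (x n)
    have hx : ∀ n, seqProd A i n *ᵥ v = x n := by
      intro n
      induction n with
      | zero => simp [x]
      | succ n ih => rw [seqProd_succ, ← Matrix.mulVec_mulVec, ih]
    have hBx : ∀ n, B (x n) = ‖lam‖ ^ n * B v := by
      intro n
      induction n with
      | zero => simp [x]
      | succ n ih =>
        change B (A (b (x n)) *ᵥ x n) = _
        rw [hb, ih, pow_succ', mul_assoc]
    obtain ⟨m, hm⟩ : ∃ m, ∀ n ≥ m, i n = a := by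
      by_contra! hcon
      obtain ⟨C, hC, hBC⟩ := exists_seminorm_mulVec_le B v
      have h0 := (h.tendsto_norm_seqProd_div hcon).const_mul C
      rw [mul_zero] at h0
      refine not_le.2 hBv (ge_of_tendsto' h0 fun n => ?_)
      have h1 := hBC (seqProd A i n)
      rw [hx, hBx] at h1
      rw [← mul_div_assoc, le_div_iff₀ (by positivity)]
      linarith
    have hconst : ∀ n, B (A a ^ (n + 1) *ᵥ x m) / ‖lam‖ ^ (n + 1) = B (x m) := by
      intro n
      have h1 : A a ^ (n + 1) *ᵥ x m = x (m + (n + 1)) := by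
        rw [← hx m, ← hx, seqProd_add, Matrix.mulVec_mulVec, ← seqProd_const]
        congr 2
        exact seqProd_congr A fun t _ => (hm _ (by omega)).symm
      rw [h1, hBx, hBx, pow_add]
      field_simp
    have h2 : B (x m) = ‖φ ⬝ᵥ x m‖ * B u := by
      refine tendsto_nhds_unique ?_ (h.tendsto_seminorm_pow B (x m))
      simp only [hconst]
      exact tendsto_const_nhds
    have h3 := h.le_functionalSeminorm i m v
    rw [hx, div_le_iff₀ (by positivity)] at h3
    rw [hBx] at h2
    have h4 : ‖lam‖ ^ m * B v ≤ ‖lam‖ ^ m * (B u * h.functionalSeminorm v) := by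
      rw [h2]
      calc ‖φ ⬝ᵥ x m‖ * B u ≤ h.functionalSeminorm v * ‖lam‖ ^ m * B u :=
            mul_le_mul_of_nonneg_right h3 hBu.le
        _ = _ := by ring
    exact le_of_mul_le_mul_left h4 (by positivity)
  · rw [← le_div_iff₀' hBu]
    refine h.functionalSeminorm_le fun i n => ?_
    rw [le_div_iff₀' hBu]
    have h1 : ‖φ ⬝ᵥ (seqProd A i n *ᵥ v)‖ * B u ≤ B (seqProd A i n *ᵥ v) := by
      refine le_of_tendsto' (h.tendsto_seminorm_pow B _) fun k => ?_
      rw [div_le_iff₀ (by positivity), mul_comm]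
      have h2 := h.seminorm_seqProd_le hB (fun _ => a) (k + 1) (seqProd A i n *ᵥ v)
      rwa [seqProd_const] at h2
    have h2 := h1.trans (h.seminorm_seqProd_le hB i n v)
    rw [← mul_div_assoc, div_le_iff₀ (by positivity)]
    linarith

theorem hasUniqueBarabanovNorm (h : IsDominated A a lam u φ Q) (hA : Irred A) :
    HasUniqueBarabanovNorm A := by
  refine ⟨⟨_, h.isBarabanovNorm_functionalSeminorm hA⟩, fun N N' hN hN' => ?_⟩
  have hpos : ∀ {B : Seminorm K (Fin d → K)}, IsBarabanovNorm A B → 0 < B u := fun {B} hB =>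
    lt_of_le_of_ne (apply_nonneg B u) fun h0 => h.ne_zero_left (hB.1 u h0.symm)
  have hNu := hpos hN
  refine ⟨N' u / N u, div_pos (hpos hN') hNu, fun v => ?_⟩
  rw [h.barabanovNorm_eq hN' v, h.barabanovNorm_eq hN v]
  field_simp

end IsDominated

/-! ### Perturbation of a rank one projection -/

/-- An operator `T` near the rank one projection `ψ(·) e` has an eigenvector near `e`: it is a fixed
point of `u ↦ T u + u - ψ(T u) u`, which is a contraction near `e` because its derivative at `e`
vanishes when `T` is the projection itself. -/
theorem exists_eigenvector_near {E : Type*} [NormedAddCommGroup E] [NormedSpace K E]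
    [CompleteSpace E] {e : E} {ψ : E →L[K] K} (he : ‖e‖ ≤ 1) (hψ : ‖ψ‖ ≤ 1) (hψe : ψ e = 1)
    {η : ℝ} (hη : 0 < η) (hη' : η ≤ 1 / 8) {T : E →L[K] E}
    (hT : ‖T - ψ.smulRight e‖ ≤ η / 16) :
    ∃ u, ‖u - e‖ ≤ η ∧ T u = ψ (T u) • u := by
  set H := T - ψ.smulRight e with hH
  have hTH : ∀ w, T w = ψ w • e + H w := fun w => by simp [hH]
  have hHw : ∀ w, ‖H w‖ ≤ η / 16 * ‖w‖ := fun w =>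
    (H.le_opNorm w).trans (mul_le_mul_of_nonneg_right hT (norm_nonneg _))
  have hψw : ∀ w, ‖ψ w‖ ≤ ‖w‖ := fun w =>
    (ψ.le_opNorm w).trans (mul_le_of_le_one_left (norm_nonneg _) hψ)
  let Φ : E → E := fun u => T u + u - ψ (T u) • u
  have hΦe : ‖Φ e - e‖ ≤ η / 8 := by
    have h1 : Φ e - e = H e - ψ (H e) • e := by
      simp only [Φ, hTH e, hψe, map_add, add_smul, one_smul]
      abel
    have h2 : ‖H e‖ ≤ η / 16 := (hHw e).trans (mul_le_of_le_one_right (by positivity) he)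
    have h3 : ‖ψ (H e) • e‖ ≤ η / 16 := by
      rw [norm_smul]
      exact (mul_le_of_le_one_right (norm_nonneg _) he).trans ((hψw _).trans h2)
    rw [h1]
    linarith [norm_sub_le (H e) (ψ (H e) • e)]
  have hball : ∀ u, ‖u - e‖ ≤ η → ‖u‖ ≤ 2 := fun u hu => by
    have := norm_add_le (u - e) e
    rw [sub_add_cancel] at this
    linarith
  have hlip : ∀ u v, ‖u - e‖ ≤ η → ‖v - e‖ ≤ η → ‖Φ u - Φ v‖ ≤ 1 / 2 * ‖u - v‖ := by
    intro u v hu hv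
    set w := u - v with hw
    have h1 : Φ u - Φ v = ψ w • (e - u) + H w - ψ (H w) • u + (ψ (e - v) - ψ (H v)) • w := by
      have huw : u = v + w := by rw [hw]; abel
      simp only [Φ, hTH, map_add, map_smul, map_sub, smul_eq_mul, hψe, mul_one]
      rw [huw]
      simp only [map_add, add_smul, smul_add, sub_smul, smul_sub, one_smul]
      abel
    have a1 : ‖ψ w • (e - u)‖ ≤ ‖w‖ * η := by
      rw [norm_smul, norm_sub_rev]
      exact mul_le_mul (hψw w) hu (norm_nonneg _) (norm_nonneg _)
    have a2 := hHw w
    have a3 : ‖ψ (H w) • u‖ ≤ (η / 16 * ‖w‖) * 2 := by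
      rw [norm_smul]
      exact mul_le_mul ((hψw _).trans a2) (hball u hu) (norm_nonneg _) (by positivity)
    have a4 : ‖(ψ (e - v) - ψ (H v)) • w‖ ≤ (η + η / 16 * 2) * ‖w‖ := by
      rw [norm_smul]
      refine mul_le_mul_of_nonneg_right ((norm_sub_le _ _).trans (add_le_add ?_ ?_)) (norm_nonneg _)
      · exact (hψw _).trans (by rwa [norm_sub_rev])
      · exact (hψw _).trans ((hHw v).trans
          (mul_le_mul_of_nonneg_left (hball v hv) (by positivity)))
    have a5 : ‖Φ u - Φ v‖ ≤ ‖ψ w • (e - u)‖ + ‖H w‖ + ‖ψ (H w) • u‖ +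
        ‖(ψ (e - v) - ψ (H v)) • w‖ := by
      rw [h1]
      refine (norm_add_le _ _).trans (add_le_add_left ((norm_sub_le _ _).trans ?_) _)
      exact add_le_add_left (norm_add_le _ _) _
    have a6 : η * ‖w‖ ≤ 1 / 8 * ‖w‖ := mul_le_mul_of_nonneg_right hη' (norm_nonneg _)
    linarith [norm_nonneg w]
  have hmaps : Set.MapsTo Φ (Metric.closedBall e η) (Metric.closedBall e η) := by
    intro u hu
    rw [mem_closedBall_iff_norm] at hu ⊢
    have h1 := hlip u e hu (by simpa using hη.le)
    have h2 := norm_add_le (Φ u - Φ e) (Φ e - e)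
    rw [sub_add_sub_cancel] at h2
    linarith
  have hcontr : ContractingWith (1 / 2) (hmaps.restrict Φ _ _) := by
    refine ⟨by norm_num, LipschitzWith.of_dist_le_mul fun u v => ?_⟩
    have h1 := hlip u v (mem_closedBall_iff_norm.1 u.2) (mem_closedBall_iff_norm.1 v.2)
    simpa [Subtype.dist_eq, dist_eq_norm] using h1
  obtain ⟨u, hu, hfix, -⟩ := hcontr.exists_fixedPoint' Metric.isClosed_closedBall.isComplete hmaps
    (Metric.mem_closedBall_self hη.le) (edist_ne_top _ _)
  refine ⟨u, mem_closedBall_iff_norm.1 hu, ?_⟩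
  have h1 : T u + u - ψ (T u) • u = u := hfix
  rw [add_sub_right_comm, add_eq_right, sub_eq_zero] at h1
  exact h1

/-- A matrix near the orthogonal projection onto the line of a unit vector `e` has an eigenvector
near `e`. -/
theorem eventually_exists_eigenvector {e : Fin d → K} (he : star e ⬝ᵥ e = 1) {η : ℝ} (hη : 0 < η) :
    ∀ᶠ M in 𝓝 (Matrix.vecMulVec e (star e)), ∃ u : Fin d → K, dist u e ≤ η ∧
      ∃ c : K, M *ᵥ u = c • u := by
  set η' := min η (1 / 8) with hη'
  have hη0 : 0 < η' := lt_min hη (by norm_num)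
  set e' : EuclideanSpace K (Fin d) := WithLp.toLp 2 e
  have hinner : ∀ v : EuclideanSpace K (Fin d), inner K e' v = star e ⬝ᵥ v.ofLp := fun v => by
    rw [EuclideanSpace.inner_eq_star_dotProduct, dotProduct_comm]
  have hnorm : ‖e'‖ = 1 := by
    have h1 := inner_self_eq_norm_sq_to_K (𝕜 := K) e'
    rw [hinner, he] at h1
    have h2 : ‖e'‖ ^ 2 = 1 := by exact_mod_cast h1.symm
    exact (pow_eq_one_iff_of_nonneg (norm_nonneg _) two_ne_zero).1 h2
  filter_upwards [Metric.closedBall_mem_nhds (Matrix.vecMulVec e (star e))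
    (by positivity : 0 < η' / 16)] with M hM
  rw [mem_closedBall_iff_norm] at hM
  have hproj : Matrix.toEuclideanCLM (n := Fin d) (𝕜 := K) (Matrix.vecMulVec e (star e)) =
      (innerSL K e').smulRight e' := by
    ext v j
    simp [hinner, Matrix.vecMulVec_mulVec, e', mul_comm]
  obtain ⟨u, hu, hTu⟩ := exists_eigenvector_near (e := e') (ψ := innerSL K e') hnorm.le
    (by rw [innerSL_apply_norm, hnorm]) (by rw [innerSL_apply_apply, hinner]; exact he)
    hη0 (min_le_right _ _)
    (T := Matrix.toEuclideanCLM (n := Fin d) (𝕜 := K) M)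
    (by rw [← hproj, ← map_sub, Matrix.l2_opNorm_toEuclideanCLM]; exact hM)
  refine ⟨u.ofLp, (dist_pi_le_iff hη.le).2 fun j => ?_,
    innerSL K e' (Matrix.toEuclideanCLM (n := Fin d) (𝕜 := K) M u), ?_⟩
  · rw [dist_eq_norm]
    exact (PiLp.norm_apply_le (u - e') j).trans (hu.trans (min_le_left _ _))
  · have := congrArg WithLp.ofLp hTu
    rwa [Matrix.ofLp_toEuclideanCLM] at this

/-- A matrix near the orthogonal projection `E` onto a line splits as `lam • P + Q` with a rank one
projection `P` near `E`, with `lam` near `1` and `Q` small. -/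
theorem eventually_exists_splitting {e : Fin d → K} (he : star e ⬝ᵥ e = 1) :
    ∀ᶠ M in 𝓝 (Matrix.vecMulVec e (star e)), ∃ (lam : K) (u φ : Fin d → K)
      (Q : Matrix (Fin d) (Fin d) K), M = lam • Matrix.vecMulVec u φ + Q ∧ φ ⬝ᵥ u = 1 ∧
        Q *ᵥ u = 0 ∧ φ ᵥ* Q = 0 ∧ 3 / 4 < ‖lam‖ ∧ ‖Q‖ < 1 / 4 ∧
        ‖Matrix.vecMulVec u φ‖ < ‖Matrix.vecMulVec e (star e)‖ + 1 := by
  set E := Matrix.vecMulVec e (star e) with hE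
  -- The candidates for `P`, `lam` and `Q`, as functions of `M` and of the two eigenvectors.
  let β : (Fin d → K) × (Fin d → K) → (Fin d → K) := fun x => (x.2 ⬝ᵥ x.1)⁻¹ • x.2
  let L : Matrix (Fin d) (Fin d) K × (Fin d → K) × (Fin d → K) → K := fun x =>
    β x.2 ⬝ᵥ (x.1 *ᵥ x.2.1)
  have hβ0 : β (e, star e) = star e := by simp [β, he]
  have hEe : E *ᵥ e = e := by simp [hE, Matrix.vecMulVec_mulVec, he]
  have hL0 : L (E, e, star e) = 1 := by simp only [L]; rw [hβ0, hEe, he]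
  have hβc : ContinuousAt β (e, star e) := by
    have h1 : Continuous fun x : (Fin d → K) × (Fin d → K) => x.2 ⬝ᵥ x.1 :=
      Continuous.dotProduct continuous_snd continuous_fst
    exact (h1.continuousAt.inv₀ (by simp [he])).smul continuousAt_snd
  have hβc' : ContinuousAt (fun x : Matrix (Fin d) (Fin d) K × (Fin d → K) × (Fin d → K) =>
      β x.2) (E, e, star e) :=
    ContinuousAt.comp (f := Prod.snd) (x := (E, e, star e)) hβc continuousAt_snd
  have hPc : ContinuousAt (fun x : Matrix (Fin d) (Fin d) K × (Fin d → K) × (Fin d → K) =>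
      Matrix.vecMulVec x.2.1 (β x.2)) (E, e, star e) := by
    have h1 : Continuous fun x : (Fin d → K) × (Fin d → K) => Matrix.vecMulVec x.1 x.2 :=
      Continuous.matrix_vecMulVec continuous_fst continuous_snd
    exact h1.continuousAt.comp (ContinuousAt.prodMk (by fun_prop) hβc')
  have hLc : ContinuousAt L (E, e, star e) := by
    have h1 : Continuous fun x : (Fin d → K) × (Fin d → K) => x.1 ⬝ᵥ x.2 :=
      Continuous.dotProduct continuous_fst continuous_snd
    have h2 : Continuous fun x : Matrix (Fin d) (Fin d) K × (Fin d → K) × (Fin d → K) =>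
        x.1 *ᵥ x.2.1 := Continuous.matrix_mulVec continuous_fst (by fun_prop)
    exact ContinuousAt.comp (f := fun x : Matrix (Fin d) (Fin d) K × (Fin d → K) × (Fin d → K) =>
      (β x.2, x.1 *ᵥ x.2.1)) (x := (E, e, star e)) h1.continuousAt (hβc'.prodMk h2.continuousAt)
  have hQc : ContinuousAt (fun x : Matrix (Fin d) (Fin d) K × (Fin d → K) × (Fin d → K) =>
      x.1 - L x • Matrix.vecMulVec x.2.1 (β x.2)) (E, e, star e) :=
    continuousAt_fst.sub (hLc.smul hPc)
  have e1 : ∀ᶠ x in 𝓝 (E, e, star e), 3 / 4 < ‖L x‖ :=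
    hLc.norm.eventually (lt_mem_nhds (by simp only [hL0]; norm_num))
  have e2 : ∀ᶠ x in 𝓝 (E, e, star e),
      ‖x.1 - L x • Matrix.vecMulVec x.2.1 (β x.2)‖ < 1 / 4 := by
    refine hQc.norm.eventually (gt_mem_nhds ?_)
    simp only [hL0, hβ0]
    rw [one_smul, ← hE, sub_self, norm_zero]
    norm_num
  have e3 : ∀ᶠ x in 𝓝 (E, e, star e), ‖Matrix.vecMulVec x.2.1 (β x.2)‖ < ‖E‖ + 1 := by
    refine hPc.norm.eventually (gt_mem_nhds ?_)
    simp only [hβ0]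
    rw [← hE]
    linarith
  have e4 : ∀ᶠ x in 𝓝 (E, e, star e), x.2.2 ⬝ᵥ x.2.1 ≠ 0 := by
    have h1 : Continuous fun x : Matrix (Fin d) (Fin d) K × (Fin d → K) × (Fin d → K) =>
        x.2.2 ⬝ᵥ x.2.1 := Continuous.dotProduct (by fun_prop) (by fun_prop)
    exact h1.continuousAt.eventually_ne (by simp [he])
  obtain ⟨ε, hε, hball⟩ := Metric.eventually_nhds_iff_ball.1 (e1.and (e2.and (e3.and e4)))
  have hstar : Tendsto (fun M : Matrix (Fin d) (Fin d) K => Mᴴ) (𝓝 E) (𝓝 E) := by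
    have h1 : Eᴴ = E := by rw [hE, Matrix.conjTranspose_vecMulVec, star_star]
    have h2 : Continuous fun M : Matrix (Fin d) (Fin d) K => Mᴴ := continuous_id.matrix_conjTranspose
    have h3 := h2.tendsto E
    rwa [h1] at h3
  have hev := eventually_exists_eigenvector he (half_pos hε)
  filter_upwards [hev, hstar.eventually hev, Metric.ball_mem_nhds E hε] with M hM hM' hME
  obtain ⟨u, hu, c, hc⟩ := hM
  obtain ⟨y, hy, c', hc'⟩ := hM'
  have hmem : (M, u, star y) ∈ Metric.ball (E, e, star e) ε := by
    have h1 : dist (star y) (star e) ≤ ε / 2 := by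
      refine (dist_pi_le_iff (half_pos hε).le).2 fun j => ?_
      rw [Pi.star_apply, Pi.star_apply, dist_eq_norm, ← star_sub, norm_star, ← dist_eq_norm]
      exact (dist_le_pi_dist y e j).trans hy
    rw [Metric.mem_ball, Prod.dist_eq, Prod.dist_eq]
    exact max_lt hME (max_lt (by linarith) (by linarith))
  obtain ⟨b1, b2, b3, b4⟩ := hball _ hmem
  have hφu : β (u, star y) ⬝ᵥ u = 1 := by
    simp only [β, smul_dotProduct, smul_eq_mul]
    exact inv_mul_cancel₀ b4
  have hL : L (M, u, star y) = c := by
    simp only [L]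
    rw [hc, dotProduct_smul, hφu, smul_eq_mul, mul_one]
  have hφM : β (u, star y) ᵥ* M = star c' • β (u, star y) := by
    have h1 : star y ᵥ* M = star c' • star y := by
      rw [← star_smul, ← hc', Matrix.star_mulVec, Matrix.conjTranspose_conjTranspose]
    simp only [β, Matrix.smul_vecMul, h1]
    rw [smul_comm]
  have hcc : star c' = c := by
    have h1 := Matrix.dotProduct_mulVec (β (u, star y)) M u
    rw [hc, hφM, dotProduct_smul, smul_dotProduct (star c'), hφu] at h1
    simpa using h1.symm
  refine ⟨L (M, u, star y), u, β (u, star y),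
    M - L (M, u, star y) • Matrix.vecMulVec u (β (u, star y)), by abel, hφu, ?_, ?_, b1, b2, b3⟩
  · rw [Matrix.sub_mulVec, hc, Matrix.smul_mulVec, Matrix.vecMulVec_mulVec, hφu, hL]
    simp
  · rw [Matrix.vecMul_sub, hφM, Matrix.vecMul_smul, Matrix.vecMul_vecMulVec, hφu, hL, hcc]
    simp

/-! ### Irreducibility -/

/-- If the products `A_b ^ s A_a A_b ^ t` with `s, t < d` are linearly independent, then they span
all matrices, and the tuple is irreducible. -/
theorem irred_of_linearIndependent {A : Tuple K r d} {a b : Fin r}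
    (h : LinearIndependent K fun p : Fin d × Fin d =>
      A b ^ (p.1 : ℕ) * A a * A b ^ (p.2 : ℕ)) : Irred A := by
  intro V hV
  have hspan := h.span_eq_top_of_card_eq_finrank' (by simp [Module.finrank_matrix])
  have hpow : ∀ (n : ℕ), ∀ v ∈ V, A b ^ n *ᵥ v ∈ V := fun n v hv => by
    induction n with
    | zero => simpa using hv
    | succ n ih =>
      rw [pow_succ', ← Matrix.mulVec_mulVec]
      exact hV b _ ih
  have hall : ∀ M : Matrix (Fin d) (Fin d) K, ∀ v ∈ V, M *ᵥ v ∈ V := by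
    intro M v hv
    have hM : M ∈ Submodule.span K (Set.range fun p : Fin d × Fin d =>
      A b ^ (p.1 : ℕ) * A a * A b ^ (p.2 : ℕ)) := by rw [hspan]; trivial
    induction hM using Submodule.span_induction with
    | mem x hx =>
      obtain ⟨p, rfl⟩ := hx
      dsimp only
      rw [← Matrix.mulVec_mulVec, ← Matrix.mulVec_mulVec]
      exact hpow _ _ (hV a _ (hpow _ v hv))
    | zero => simp
    | add x y _ _ hx hy => rw [Matrix.add_mulVec]; exact V.add_mem hx hy
    | smul c x _ hx => rw [Matrix.smul_mulVec]; exact V.smul_mem c hx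
  by_cases h0 : V = ⊥
  · exact Or.inl h0
  · right
    obtain ⟨v, hv, hv0⟩ := V.ne_bot_iff.1 h0
    obtain ⟨j, hj⟩ := Function.ne_iff.1 hv0
    rw [eq_top_iff]
    intro w _
    have h1 := hall (Matrix.vecMulVec w (Pi.single j (v j)⁻¹)) v hv
    have hj' : v j ≠ 0 := hj
    simpa [Matrix.vecMulVec_mulVec, hj'] using h1

theorem isOpen_setOf_linearIndependent_products (a b : Fin r) :
    IsOpen {A : Tuple K r d | LinearIndependent K fun p : Fin d × Fin d =>
      A b ^ (p.1 : ℕ) * A a * A b ^ (p.2 : ℕ)} := by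
  refine (isOpen_setOfPred_linearIndependent (𝕜 := K) (E := Matrix (Fin d) (Fin d) K)
    (ι := Fin d × Fin d)).preimage (continuous_pi fun p => ?_)
  exact (((continuous_apply b).pow _).mul (continuous_apply a)).mul ((continuous_apply b).pow _)

/-- By the invertibility of a Vandermonde matrix, a diagonal matrix with distinct entries and the
projection onto a vector without zero entries generate all matrices. -/
theorem linearIndependent_diagonal_products {s e f : Fin d → K} (hs : Function.Injective s)
    (he : ∀ j, e j ≠ 0) (hf : ∀ j, f j ≠ 0) :
    LinearIndependent K fun p : Fin d × Fin d =>
      Matrix.diagonal s ^ (p.1 : ℕ) * Matrix.vecMulVec e f * Matrix.diagonal s ^ (p.2 : ℕ) := by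
  have hdet : IsUnit (Matrix.vandermonde s) := by
    rw [Matrix.isUnit_iff_isUnit_det, isUnit_iff_ne_zero]
    exact Matrix.det_vandermonde_ne_zero_iff.2 hs
  rw [Fintype.linearIndependent_iff]
  intro c hc
  have h1 : Matrix.vandermonde s * (Matrix.of fun x y => c (x, y)) *
      (Matrix.vandermonde s)ᵀ = 0 := by
    ext i j
    have h2 := congrFun (congrFun hc i) j
    rw [Matrix.sum_apply, Fintype.sum_prod_type] at h2
    have h3 : e i * f j * ∑ y : Fin d, ∑ x : Fin d, s i ^ (x : ℕ) * c (x, y) * s j ^ (y : ℕ) = 0 := by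
      rw [Finset.sum_comm, Finset.mul_sum]
      simp only [Finset.mul_sum]
      refine Eq.trans ?_ h2
      refine Finset.sum_congr rfl fun x _ => Finset.sum_congr rfl fun y _ => ?_
      simp [Matrix.diagonal_pow, Matrix.vecMulVec_apply]
      ring
    have h4 := (mul_eq_zero.1 h3).resolve_left (mul_ne_zero (he i) (hf j))
    simpa [Matrix.mul_apply, Finset.sum_mul, Matrix.vandermonde_apply] using h4
  have h5 : (Matrix.of fun x y => c (x, y)) = 0 := by
    have hT : IsUnit (Matrix.vandermonde s)ᵀ := (Matrix.isUnit_transpose _).2 hdet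
    rwa [hT.mul_left_eq_zero, hdet.mul_right_eq_zero] at h1
  rintro ⟨x, y⟩
  exact congrFun (congrFun h5 x) y

end MatrixTuple

theorem mainTheorem3 {K : Type*} [RCLike K] (r d : ℕ) (hr : 2 ≤ r) (hd : 2 ≤ d) :
    ∃ U : Set (MatrixTuple.Tuple K r d),
      IsOpen U ∧ U.Nonempty ∧ (∀ A ∈ U, MatrixTuple.Irred A) ∧
        ∀ A ∈ U, MatrixTuple.FinitenessProperty A ∧ MatrixTuple.UnboundedAgreements A ∧
          MatrixTuple.RankOneProperty A ∧ MatrixTuple.HasUniqueBarabanovNorm A := by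
  have hd0 : (0 : ℝ) < d := by exact_mod_cast (by omega : 0 < d)
  set a : Fin r := ⟨0, by omega⟩
  set b : Fin r := ⟨1, by omega⟩
  have hab : b ≠ a := by simp [a, b]
  -- The all-ones unit vector and the projection onto its line.
  set e : Fin d → K := fun _ => (((Real.sqrt d)⁻¹ : ℝ) : K) with he_def
  have he : star e ⬝ᵥ e = 1 := by
    have h1 : ((Real.sqrt d)⁻¹ * (Real.sqrt d)⁻¹ : ℝ) = (d : ℝ)⁻¹ := by
      rw [← mul_inv, Real.mul_self_sqrt hd0.le]
    have h2 : (d : K) ≠ 0 := by exact_mod_cast hd0.ne'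
    simp only [dotProduct, he_def, Pi.star_apply, RCLike.star_def, RCLike.conj_ofReal]
    rw [Finset.sum_const, ← RCLike.ofReal_mul, h1]
    simp [h2]
  have he0 : ∀ j, e j ≠ 0 := fun j => by
    rw [he_def]
    exact RCLike.ofReal_ne_zero.2 (by positivity)
  set E := Matrix.vecMulVec e (star e) with hE
  obtain ⟨W, hW, hWo, hEW⟩ := eventually_nhds_iff.1 (MatrixTuple.eventually_exists_splitting he)
  -- With `‖P‖ < ‖E‖ + 1` and `3 / 4 < ‖lam‖`, matrices of norm less than `κ` satisfy the bound
  -- `(1 + 2 * ‖P‖) * ‖A i‖ ≤ ‖lam‖ / 2` in the definition of `IsDominated`.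
  set κ : ℝ := 3 / 8 / (1 + 2 * (‖E‖ + 1)) with hκ
  have hκ0 : 0 < κ := by positivity
  let U : Set (MatrixTuple.Tuple K r d) := {A | A a ∈ W} ∩ {A | ∀ i, i ≠ a → ‖A i‖ < κ} ∩
    {A | LinearIndependent K fun p : Fin d × Fin d =>
      A b ^ (p.1 : ℕ) * A a * A b ^ (p.2 : ℕ)}
  have hirr : ∀ A ∈ U, MatrixTuple.Irred A := fun A hA =>
    MatrixTuple.irred_of_linearIndependent hA.2
  refine ⟨U, ?_, ?_, hirr, fun A hA => ?_⟩
  · refine ((hWo.preimage (continuous_apply a)).inter ?_).inter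
      (MatrixTuple.isOpen_setOf_linearIndependent_products a b)
    simp only [Set.ofPred_forall]
    exact isOpen_iInter_of_finite fun i => isOpen_iInter_of_finite fun _ =>
      isOpen_lt (continuous_apply i).norm continuous_const
  · -- The base point: the projection `E` and a small diagonal matrix with distinct entries.
    set t : ℝ := κ / (d + 1) with ht
    have ht0 : 0 < t := by positivity
    set s : Fin d → K := fun j => ((t * (j : ℕ) : ℝ) : K) with hs_def
    have hs : Function.Injective s := fun i j hij => by
      have h1 : t * ((i : ℕ) : ℝ) = t * ((j : ℕ) : ℝ) := RCLike.ofReal_injective hij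
      exact Fin.ext (by exact_mod_cast mul_left_cancel₀ ht0.ne' h1)
    have hsn : ‖(Matrix.diagonal s : Matrix (Fin d) (Fin d) K)‖ < κ := by
      rw [Matrix.l2_opNorm_diagonal, pi_norm_lt_iff hκ0]
      intro j
      have hj : ((j : ℕ) : ℝ) < d + 1 := by exact_mod_cast j.2.trans (Nat.lt_succ_self d)
      rw [hs_def, RCLike.norm_ofReal, abs_of_nonneg (by positivity), ht, div_mul_eq_mul_div,
        div_lt_iff₀ (by positivity)]
      exact mul_lt_mul_of_pos_left hj hκ0
    refine ⟨fun i => if i = a then E else Matrix.diagonal s, ⟨?_, fun i hi => ?_⟩, ?_⟩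
    · simpa using hEW
    · simpa [hi] using hsn
    · simp only [Set.mem_ofPred_eq, if_neg hab, if_true]
      exact MatrixTuple.linearIndependent_diagonal_products hs he0 fun j => by simpa using he0 j
  · obtain ⟨⟨hAW, hAκ⟩, -⟩ := id hA
    obtain ⟨lam, u, φ, Q, h1, h2, h3, h4, h5, h6, h7⟩ := hW _ hAW
    have hdom : MatrixTuple.IsDominated A a lam u φ Q := by
      refine ⟨h1, h2, h3, h4, norm_pos_iff.1 (by linarith), by linarith, fun i hi => ?_⟩
      have h8 : (1 + 2 * ‖Matrix.vecMulVec u φ‖) * ‖A i‖ ≤ (1 + 2 * (‖E‖ + 1)) * κ :=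
        mul_le_mul (by linarith) (hAκ i hi).le (norm_nonneg _) (by positivity)
      have h9 : (1 + 2 * (‖E‖ + 1)) * κ = 3 / 8 := by rw [hκ]; field_simp
      linarith
    exact ⟨hdom.finitenessProperty, hdom.unboundedAgreements, hdom.rankOneProperty,
      hdom.hasUniqueBarabanovNorm (hirr A hA)⟩
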